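/- Conventions. Let $r\in\{\infty,\omega\}$ ($\omega$ = real analytic). A $C^r$ local diffeomorphism of $(\mathbb R^n,0)$ is a map $F$ with $F(0)=0$ that restricts to a $C^r$ diffeomorphism between open neighbourhoods of $0$. A $C^r$ (autonomous) embedding vector field of $F$ is a $C^r$ vector field $X$ on an open neighbourhood $U$ of $0$ such that, for all $x$ sufficiently close to $0$, the solution of $\dot\gamma=X(\gamma)$, $\gamma(0)=x$, exists in $U$ for $0\le t\le 1$ and satisfies $\gamma(1)=F(x)$. A real matrix $A$ is hyperbolic if it has no complex eigenvalue of modulus $1$. A real logarithm of $A$ is a real matrix $B$ with $e^B=A$. The eigenvalues $(\mu_1,\dots,\mu_n)$ of $B$ (listed with multiplicity) are weakly resonant if $\mu_j-\sum_i k_i\mu_i=2l\pi\sqrt{-1}$ for some $j$, some $k\in\mathbb Z_{\ge 0}^n$ with $|k|=\sum_i k_i\ge 2$, and some $l\in\mathbb Z\setminus\{0\}$. Theorem. Let $n\ge 3$. (1) For $r=\infty$, and likewise for $r=\omega$, there is a $C^r$ local diffeomorphism $F(x)=Ax+f(x)$ of $(\mathbb R^n,0)$ such that $f(x)=O(|x|^2)$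 as $x\to0$, $A$ is hyperbolic and has a real logarithm whose eigenvalues are weakly resonant, and $F$ has no $C^r$ autonomous embedding vector field. (So, for hyperbolic $F$ whose linear part has a real logarithm, weak nonresonance of the eigenvalues of that logarithm cannot be dropped as a condition for the existence of an embedding vector field.) (2) Explicit examples are as follows. Call real numbers $\lambda_4,\dots,\lambda_n>1$ admissible if, with $\lambda_1=e^8$ and $\lambda_{2}=e^{1+\frac{\pi}{4}\sqrt{-1}}$, $\lambda_3=e^{1-\frac{\pi}{4}\sqrt{-1}}$, the only relations $\lambda_j=\lambda_1^{k_1}\cdots\lambda_n^{k_n}$ with $k\in\mathbb Z_{\ge0}^n$, $|k|\ge2$, are $\lambda_1=\lambda_2^4\lambda_3^4$, $\lambda_1=\lambda_2^8$ and $\lambda_1=\lambda_3^8$. Admissible numbers exist. Let $\lambda_4,\dots,\lambda_n$ be admissible, $a\in\mathbb R$, $b\in\mathbb C\setminus\{0\}$, put $z=x_2-\sqrt{-1}\,x_3$, and let $$A=\mathrm{diag}\left(e^8,\ e\begin{pmatrix}\cos\frac\pi4&\sin\frac\pi4\\-\sin\frac\pi4&\cos\frac\pi4\end{pmatrix},\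 \lambda_4,\dots,\lambda_n\right),\qquad B=\mathrm{diag}\left(8,\ \begin{pmatrix}1&\frac\pi4\\-\frac\pi4&1\end{pmatrix},\ \ln\lambda_4,\dots,\ln\lambda_n\right),$$ $$f(x)=\left(a|z|^8+bz^8+\bar b\,\bar z^8,\,0,\dots,0\right).$$ Then $f(x)=O(|x|^2)$ as $x\to0$, $F(x)=Ax+f(x)$ is an analytic local diffeomorphism of $(\mathbb R^n,0)$, $A$ is hyperbolic with eigenvalues $\lambda_1,\dots,\lambda_n$, $e^B=A$, the eigenvalues of $B$ are weakly resonant, and $F$ has neither a $C^\infty$ nor an analytic autonomous embedding vector field. -/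

import Mathlib

open scoped ContDiff Topology Manifold

namespace EmbeddingFlow

/-- `ℝⁿ` with its Euclidean norm. -/
abbrev Rn (n : ℕ) : Type := EuclideanSpace ℝ (Fin n)

/-- The map `x ↦ A x + f x` on `ℝⁿ`. -/
noncomputable def perturbed {n : ℕ} (A : Matrix (Fin n) (Fin n) ℝ) (f : Rn n → Rn n) :
    Rn n → Rn n :=
  fun x => Matrix.toEuclideanCLM (n := Fin n) (𝕜 := ℝ) A x + f x

/-- `F` is (the germ of) a local diffeomorphism of class `C^r` of `(ℝⁿ, 0)`: it fixes the origin and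
agrees near the origin with a bijection between open sets that is `C^r` in both directions.
Here `r = ∞` means smooth and `r = ω` means real analytic. -/
def IsLocalDiffeo {n : ℕ} (r : WithTop ℕ∞) (F : Rn n → Rn n) : Prop :=
  F 0 = 0 ∧ IsLocalDiffeomorphAt 𝓘(ℝ, Rn n) 𝓘(ℝ, Rn n) r F 0

/-- `X` is an (autonomous) embedding vector field of class `C^r` of the germ of `F` at the origin:
`X` is `C^r` on some open neighbourhood `U` of the origin, and for all `x` close to the origin the
solution of `γ' = X(γ)`, `γ(0) = x` exists in `U` for times `0 ≤ t ≤ 1` and satisfies `γ(1) = F(x)`.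
That is, `F` is the time-one map of the local flow of `X`. -/
def IsEmbeddingVectorField {n : ℕ} (r : WithTop ℕ∞) (X F : Rn n → Rn n) : Prop :=
  ∃ U : Set (Rn n), IsOpen U ∧ (0 : Rn n) ∈ U ∧ ContDiffOn ℝ r X U ∧
    ∀ᶠ x in 𝓝 (0 : Rn n), ∃ γ : ℝ → Rn n,
      γ 0 = x ∧ γ 1 = F x ∧ (∀ t ∈ Set.Icc (0 : ℝ) 1, γ t ∈ U) ∧
        IsIntegralCurveOn γ (fun _ => X) (Set.Icc (0 : ℝ) 1)

/-- `μ` lists the complex eigenvalues of the real matrix `M` with their algebraic multiplicities. -/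
def IsEigenvalueTuple {n : ℕ} (M : Matrix (Fin n) (Fin n) ℝ) (μ : Fin n → ℂ) : Prop :=
  (M.map Complex.ofReal).charpoly = ∏ i, (Polynomial.X - Polynomial.C (μ i))

/-- No eigenvalue of the real matrix `M` lies on the unit circle. -/
def IsHyperbolic {n : ℕ} (M : Matrix (Fin n) (Fin n) ℝ) : Prop :=
  ∀ z : ℂ, (M.map Complex.ofReal).charpoly.IsRoot z → ‖z‖ ≠ 1

/-- A tuple of eigenvalues of (the linear part of) a vector field is weakly resonant. -/
def WeaklyResonant {n : ℕ} (μ : Fin n → ℂ) : Prop :=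
  ∃ (k : Fin n → ℕ) (j : Fin n) (l : ℤ), 2 ≤ ∑ i, k i ∧ l ≠ 0 ∧
    μ j - ∑ i, (k i : ℂ) * μ i = 2 * (l : ℂ) * (Real.pi : ℂ) * Complex.I

/-- The block diagonal matrix `diag(P, d₃, …, d_{n-1})` with a `3 × 3` block `P`
(indices start at `0`; the entries `d₀, d₁, d₂` play no role). -/
def blockDiag {n : ℕ} (P : Matrix (Fin 3) (Fin 3) ℝ) (d : Fin n → ℝ) :
    Matrix (Fin n) (Fin n) ℝ :=
  Matrix.of fun i j =>
    if h : (i : ℕ) < 3 ∧ (j : ℕ) < 3 then P ⟨i, h.1⟩ ⟨j, h.2⟩ else if i = j then d i else 0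

/-- The `3 × 3` block with eigenvalues `e⁸` and `e^{1 ± iπ/4}`. -/
noncomputable def blockA : Matrix (Fin 3) (Fin 3) ℝ :=
  !![Real.exp 8, 0, 0;
     0, √2 / 2 * Real.exp 1, √2 / 2 * Real.exp 1;
     0, -(√2 / 2 * Real.exp 1), √2 / 2 * Real.exp 1]

/-- The `3 × 3` block with eigenvalues `8` and `1 ± iπ/4`. -/
noncomputable def blockB : Matrix (Fin 3) (Fin 3) ℝ :=
  !![8, 0, 0;
     0, 1, Real.pi / 4;
     0, -(Real.pi / 4), 1]

/-- The eigenvalues `e⁸, e^{1+iπ/4}, e^{1-iπ/4}, d₃, …, d_{n-1}` of `diag(blockA, d₃, …, d_{n-1})`. -/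
noncomputable def exampleEigenvalues {n : ℕ} (d : Fin n → ℝ) (i : Fin n) : ℂ :=
  if (i : ℕ) = 0 then Complex.exp 8
  else if (i : ℕ) = 1 then Complex.exp (1 + Real.pi / 4 * Complex.I)
  else if (i : ℕ) = 2 then Complex.exp (1 - Real.pi / 4 * Complex.I)
  else (d i : ℂ)

/-- The numbers `d₃, …, d_{n-1}` are larger than `1`, and among the eigenvalues
`λ₀ = e⁸, λ₁ = e^{1+iπ/4}, λ₂ = e^{1-iπ/4}, λ₃ = d₃, …` the only resonances `λ_j = λ^k`, `|k| ≥ 2`, are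
`λ₀ = λ₁⁴ λ₂⁴`, `λ₀ = λ₁⁸` and `λ₀ = λ₂⁸`. -/
def Admissible {n : ℕ} (d : Fin n → ℝ) : Prop :=
  (∀ i : Fin n, 3 ≤ (i : ℕ) → 1 < d i) ∧
    ∀ (k : Fin n → ℕ) (j : Fin n), 2 ≤ ∑ i, k i →
      exampleEigenvalues d j = ∏ i, exampleEigenvalues d i ^ k i →
      (j : ℕ) = 0 ∧ ∃ p q : ℕ, ((p = 4 ∧ q = 4) ∨ (p = 8 ∧ q = 0) ∨ (p = 0 ∧ q = 8)) ∧
        ∀ i : Fin n, k i = if (i : ℕ) = 1 then p else if (i : ℕ) = 2 then q else 0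

/-- The nonlinear term whose first component is `a |z|⁸ + b z⁸ + conj(b) conj(z)⁸`, with
`z = x₁ - i x₂` (indices start at `0`), and whose other components vanish. The coordinate `z` is the
one multiplied by `e^{1+iπ/4}` under `blockA`. -/
noncomputable def resonantTerm {n : ℕ} (hn : 3 ≤ n) (a : ℝ) (b : ℂ) (x : Rn n) : Rn n :=
  EuclideanSpace.single (⟨0, by omega⟩ : Fin n)
    (a * (x ⟨1, by omega⟩ ^ 2 + x ⟨2, by omega⟩ ^ 2) ^ 4 +
      2 * (b * ((x ⟨1, by omega⟩ : ℂ) - (x ⟨2, by omega⟩ : ℂ) * Complex.I) ^ 8).re)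

end EmbeddingFlow

/-! Why the example has no embedding vector field.

Let `F x = A x + f x` and let `X` be a smooth embedding vector field of `F`. Uniqueness of integral
curves gives `F (γ_x s) = γ_{F x} s`, and differentiating at `s = 0` yields `DF(x) X(x) = X(F(x))` near
the origin (`eventually_hasFDerivAt_apply_eq`). At `x = 0` this forces `X 0 = 0`, since `1` is not an
eigenvalue of `A`; its linearization says that `L = DX(0)` commutes with `A`. As the plane of the
complex coordinate `z` carries the only nonreal eigenvalues of `A`, the map `L` acts on `z` as the
multiplication by some `β ∈ ℂ` (`exists_planeCoord_apply_eq`).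

Now compare the terms of order `8` in the component `0` of the commutation relation, along the ray
through a point `z` of the plane. Put `g z ε = X₀ (ε z)`. As `f` is homogeneous of degree `8`, only
`L` contributes besides `g` itself, and with `λ = e^{1 + iπ/4}` one gets
`g (λ z) ε - e⁸ g z ε = K z ε⁸ + o(ε⁸)`, where `K` is the derivative of the polynomial
`a |z|⁸ + 2 Re (b z⁸)` along `z ↦ β z` minus a real multiple `α` of that polynomial
(`scaling_isLittleO`). The resonances `λ⁸ = |λ|⁸ = e⁸` give `K (λ z) = e⁸ K z`, so eight iterations
turn this into a relation for the single function `g z`, because `λ⁸` is a positive real number; its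
Taylor coefficient of order `8` drops out, and `K = 0` (`eq_zero_of_scaling_isLittleO`,
`resonantGrad_eq_of_eventually`). Since `b ≠ 0`, this gives `8 β = α`, so `β` is real
(`eight_mul_eq_of_resonantGrad`). But the linear part of the time-one map is governed by that of the
field: `Re z` is multiplied by the real number `e^β` under `A` (`fderiv_timeOne_apply`), which is
false because `λ` is not real. This is where the weak resonance enters: `A` itself satisfies
`λ⁸ = e⁸`, whereas no logarithm `β` of `λ` satisfies `8 β ∈ ℝ`.

The remaining claims are explicit. The block matrices involved form the image of the commutative ring
`ℝ × ℂ × ℝ^{n-3}` under a continuous ring homomorphism, which computes the exponential; `F` is a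
triangular map with an explicit polynomial inverse; and admissible numbers are `exp (θ ^ 2)`,
`exp (θ ^ 4)`, … with `θ` transcendental.
-/

namespace EmbeddingFlow

open Asymptotics Filter

/-! ### Taylor coefficients at a resonant order -/

lemma coeff_zero_eq_zero_of_isLittleO {n : ℕ} {c : ℕ → ℝ}
    (h : (fun x : ℝ => ∑ i ∈ Finset.range (n + 1), c i * x ^ i) =o[𝓝[≠] 0] fun x => x ^ n) :
    c 0 = 0 := by
  have h1 : Tendsto (fun x : ℝ => ∑ i ∈ Finset.range (n + 1), c i * x ^ i) (𝓝[≠] 0) (𝓝 0) := by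
    have h2 : (fun x : ℝ => x ^ n) =O[𝓝[≠] 0] fun _ => (1 : ℝ) :=
      ((continuous_pow n).tendsto (0 : ℝ)).isBigO_one ℝ |>.mono nhdsWithin_le_nhds
    exact (isLittleO_one_iff ℝ).1 (h.trans_isBigO h2)
  have h3 : Tendsto (fun x : ℝ => ∑ i ∈ Finset.range (n + 1), c i * x ^ i) (𝓝[≠] 0)
      (𝓝 (∑ i ∈ Finset.range (n + 1), c i * (0 : ℝ) ^ i)) :=
    Tendsto.mono_left (Continuous.tendsto (by fun_prop) 0) nhdsWithin_le_nhds
  have h4 := tendsto_nhds_unique h3 h1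
  rw [Finset.sum_range_succ'] at h4
  simpa using h4

/-- A polynomial of degree at most `n` that is `o(x ^ n)` at the origin vanishes. -/
lemma coeff_eq_zero_of_isLittleO (n : ℕ) (c : ℕ → ℝ)
    (h : (fun x : ℝ => ∑ i ∈ Finset.range (n + 1), c i * x ^ i) =o[𝓝[≠] 0] fun x => x ^ n) :
    ∀ i ≤ n, c i = 0 := by
  have key : c 0 = 0 := coeff_zero_eq_zero_of_isLittleO h
  induction n generalizing c with
  | zero =>
    intro i hi
    obtain rfl : i = 0 := by omega
    exact key
  | succ n ih =>
    have hs : (fun x : ℝ => ∑ i ∈ Finset.range (n + 1), c (i + 1) * x ^ i)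
        =o[𝓝[≠] 0] fun x => x ^ n := by
      have h6 := (isBigO_refl (fun x : ℝ => x⁻¹) (𝓝[≠] 0)).mul_isLittleO h
      refine h6.congr' ?_ ?_
      · filter_upwards [self_mem_nhdsWithin] with x hx
        have hx : x ≠ 0 := hx
        rw [Finset.sum_range_succ', key, mul_add, Finset.mul_sum]
        simp only [zero_mul, mul_zero, add_zero]
        refine Finset.sum_congr rfl fun i _ => ?_
        field_simp
        ring
      · filter_upwards [self_mem_nhdsWithin] with x hx
        have hx : x ≠ 0 := hx
        field_simp
        ring
    intro i hi
    cases i with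
    | zero => exact key
    | succ i =>
      exact ih (fun i => c (i + 1)) hs (coeff_zero_eq_zero_of_isLittleO hs) i (by omega)

/-- The operator `h ↦ h (c ·) - c ^ n h` kills the Taylor coefficient of order `n`, so a function of
class `C^n` cannot solve `h (c ε) - c ^ n h ε = K ε ^ n + o(ε ^ n)` unless `K = 0`. -/
lemma eq_zero_of_scaling_isLittleO {n : ℕ} {h : ℝ → ℝ} (hh : ContDiffAt ℝ n h 0) (c K : ℝ)
    (hK : (fun ε => h (c * ε) - c ^ n * h ε - K * ε ^ n) =o[𝓝 0] fun ε => ε ^ n) : K = 0 := by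
  obtain ⟨u, hu, hhu⟩ := hh.contDiffOn (m := n) le_rfl (by simp)
  obtain ⟨ρ, hρ, hρu⟩ := Metric.nhds_basis_ball.mem_iff.1 hu
  have hT := taylor_isLittleO (convex_ball (0 : ℝ) ρ) (Metric.mem_ball_self hρ) (hhu.mono hρu)
  rw [nhdsWithin_eq_nhds.2 (Metric.ball_mem_nhds _ hρ)] at hT
  simp only [sub_zero] at hT
  set t : ℕ → ℝ := fun i => (i.factorial : ℝ)⁻¹ * iteratedDerivWithin i h (Metric.ball 0 ρ) 0 with ht
  have hTe : ∀ x, taylorWithinEval h n (Metric.ball 0 ρ) 0 x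
      = ∑ i ∈ Finset.range (n + 1), t i * x ^ i := by
    intro x
    rw [taylor_within_apply]
    refine Finset.sum_congr rfl fun i _ => ?_
    simp [ht]; ring
  simp only [hTe] at hT
  have hT' : (fun ε => h (c * ε) - ∑ i ∈ Finset.range (n + 1), t i * (c * ε) ^ i)
      =o[𝓝 0] fun ε => ε ^ n := by
    have hc : Tendsto (fun ε : ℝ => c * ε) (𝓝 0) (𝓝 0) := by
      have : Continuous fun ε : ℝ => c * ε := by fun_prop
      simpa using this.tendsto 0
    refine (hT.comp_tendsto hc).trans_isBigO ?_
    refine (isBigO_const_mul_self (c ^ n) (fun ε : ℝ => ε ^ n) (𝓝 0)).congr_left fun ε => ?_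
    simp [mul_pow]
  have hP : (fun ε => ∑ i ∈ Finset.range (n + 1),
      (t i * (c ^ i - c ^ n) - if i = n then K else 0) * ε ^ i) =o[𝓝 0] fun ε => ε ^ n := by
    refine ((hK.sub hT').add (hT.const_mul_left (c ^ n))).congr_left fun ε => ?_
    have e1 : K * ε ^ n = ∑ i ∈ Finset.range (n + 1), (if i = n then K else 0) * ε ^ i := by
      simp [Finset.sum_ite_eq', ite_mul]
    have e2 : ∑ i ∈ Finset.range (n + 1),
        (t i * (c ^ i - c ^ n) - if i = n then K else 0) * ε ^ i
        = (∑ i ∈ Finset.range (n + 1), t i * (c * ε) ^ i)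
          - c ^ n * (∑ i ∈ Finset.range (n + 1), t i * ε ^ i)
          - ∑ i ∈ Finset.range (n + 1), (if i = n then K else 0) * ε ^ i := by
      rw [Finset.mul_sum, ← Finset.sum_sub_distrib, ← Finset.sum_sub_distrib]
      refine Finset.sum_congr rfl fun i _ => ?_
      rw [mul_pow]; ring
    rw [e2, ← e1]; ring
  have := coeff_eq_zero_of_isLittleO n _ (hP.mono nhdsWithin_le_nhds) n le_rfl
  simpa using this

/-! ### Integral curves of an embedding vector field -/

section Flow

variable {E : Type*} [NormedAddCommGroup E] [NormedSpace ℝ E]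

lemma integralCurve_eqOn {X : E → E} {U : Set E} (hU : IsOpen U) (hX : ContDiffOn ℝ 1 X U)
    {γ δ : ℝ → E} {a b : ℝ} (hγ : IsIntegralCurveOn γ (fun _ => X) (Set.Icc a b))
    (hδ : IsIntegralCurveOn δ (fun _ => X) (Set.Icc a b))
    (hγU : ∀ t ∈ Set.Icc a b, γ t ∈ U) (hδU : ∀ t ∈ Set.Icc a b, δ t ∈ U) (h : γ a = δ a) :
    Set.EqOn γ δ (Set.Icc a b) := by
  have hγc : ContinuousOn γ (Set.Icc a b) := fun t ht => (hγ t ht).continuousWithinAt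
  have hδc : ContinuousOn δ (Set.Icc a b) := fun t ht => (hδ t ht).continuousWithinAt
  set S : Set E := γ '' Set.Icc a b ∪ δ '' Set.Icc a b with hS
  have hSc : IsCompact S := (isCompact_Icc.image_of_continuousOn hγc).union
    (isCompact_Icc.image_of_continuousOn hδc)
  have hSU : S ⊆ U := by
    rintro _ (⟨t, ht, rfl⟩ | ⟨t, ht, rfl⟩)
    exacts [hγU t ht, hδU t ht]
  have hl : LocallyLipschitzOn S X := by
    intro x hx
    obtain ⟨K, t, ht, hK⟩ := (hX.contDiffAt (hU.mem_nhds (hSU hx))).exists_lipschitzOnWith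
    exact ⟨K, t, mem_nhdsWithin_of_mem_nhds ht, hK⟩
  obtain ⟨K, hK⟩ := hl.exists_lipschitzOnWith_of_compact hSc
  refine ODE_solution_unique_of_mem_Icc_right (v := fun _ => X) (s := fun _ => S) (K := K)
    (fun _ _ => hK) hγc (fun t ht => ?_) (fun t ht => ?_) hδc (fun t ht => ?_) (fun t ht => ?_) h
  · exact (hγ t (Set.Ico_subset_Icc_self ht)).mono_of_mem_nhdsWithin
      (Icc_mem_nhdsGE_of_mem ht)
  · exact Or.inl ⟨t, Set.Ico_subset_Icc_self ht, rfl⟩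
  · exact (hδ t (Set.Ico_subset_Icc_self ht)).mono_of_mem_nhdsWithin
      (Icc_mem_nhdsGE_of_mem ht)
  · exact Or.inr ⟨t, Set.Ico_subset_Icc_self ht, rfl⟩

lemma isIntegralCurveOn_comp_add_const {X : E → E} {γ : ℝ → E} {s a b : ℝ}
    (h : IsIntegralCurveOn γ (fun _ => X) (Set.Icc (a + s) (b + s))) :
    IsIntegralCurveOn (fun t => γ (t + s)) (fun _ => X) (Set.Icc a b) := by
  intro t ht
  have h1 := h (t + s) ⟨by linarith [ht.1], by linarith [ht.2]⟩
  have h2 : HasDerivWithinAt (fun t : ℝ => t + s) 1 (Set.Icc a b) t :=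
    ((hasDerivAt_id t).add_const s).hasDerivWithinAt
  simpa [Function.comp_def] using h1.scomp t h2
    (fun u hu => (⟨by linarith [hu.1], by linarith [hu.2]⟩ : u + s ∈ Set.Icc (a + s) (b + s)))

/-- A map conjugates the vector field that embeds it to itself: `DF(x) X(x) = X(F(x))`. This is the
derivative at `s = 0` of the identity `F (γ_x s) = γ_{F x} s`, a consequence of uniqueness of
integral curves. -/
lemma eventually_hasFDerivAt_apply_eq {X F : E → E} {U : Set E} (hU : IsOpen U)
    (hX : ContDiffOn ℝ 1 X U) (hF : ContinuousAt F 0) (hF0 : F 0 = 0)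
    (h : ∀ᶠ x in 𝓝 (0 : E), ∃ γ : ℝ → E,
      γ 0 = x ∧ γ 1 = F x ∧ (∀ t ∈ Set.Icc (0 : ℝ) 1, γ t ∈ U) ∧
        IsIntegralCurveOn γ (fun _ => X) (Set.Icc (0 : ℝ) 1)) :
    ∀ᶠ x in 𝓝 (0 : E), ∀ F' : E →L[ℝ] E, HasFDerivAt F F' x → F' (X x) = X (F x) := by
  have hFt : Tendsto F (𝓝 0) (𝓝 0) := by simpa [ContinuousAt, hF0] using hF
  filter_upwards [eventually_eventually_nhds.2 h, hFt.eventually h]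
    with x hx ⟨δ, hδ0, _, hδU, hδ⟩ F' hF'
  obtain ⟨γ, hγ0, hγ1, hγU, hγ⟩ := hx.self_of_nhds
  have m0 : (0 : ℝ) ∈ Set.Icc (0 : ℝ) 1 := by simp
  have hγt : Tendsto γ (𝓝[Set.Icc (0 : ℝ) 1] 0) (𝓝 x) := by
    simpa [hγ0, ContinuousWithinAt] using (hγ 0 m0).continuousWithinAt
  have heq : ∀ᶠ s in 𝓝[Set.Icc (0 : ℝ) 1] 0, F (γ s) = δ s := by
    filter_upwards [hγt.eventually hx, self_mem_nhdsWithin] with s ⟨σ, hσ0, hσ1, hσU, hσ⟩ hs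
    have e1 : Set.EqOn σ (fun t => γ (t + s)) (Set.Icc 0 (1 - s)) := by
      refine integralCurve_eqOn hU hX (hσ.mono ?_) (isIntegralCurveOn_comp_add_const
        (hγ.mono ?_)) (fun t ht => hσU t ⟨ht.1, by linarith [ht.2, hs.1]⟩)
        (fun t ht => hγU _ ⟨by linarith [ht.1, hs.1], by linarith [ht.2]⟩) (by simp [hσ0])
      · exact Set.Icc_subset_Icc le_rfl (by linarith [hs.1])
      · exact Set.Icc_subset_Icc (by linarith [hs.1]) (by linarith)
    have e2 : Set.EqOn (fun t => σ (t + (1 - s))) δ (Set.Icc 0 s) := by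
      refine integralCurve_eqOn hU hX (isIntegralCurveOn_comp_add_const (hσ.mono ?_))
        (hδ.mono ?_) (fun t ht => hσU _ ⟨by linarith [ht.1, hs.2], by linarith [ht.2]⟩)
        (fun t ht => hδU t ⟨ht.1, by linarith [ht.2, hs.2]⟩) ?_
      · exact Set.Icc_subset_Icc (by linarith [hs.2]) (by linarith)
      · exact Set.Icc_subset_Icc le_rfl hs.2
      · have := e1 ⟨by linarith [hs.2], le_rfl⟩
        simpa [hγ1, hδ0] using this
    have := e2 ⟨hs.1, le_rfl⟩
    simpa [hσ1] using this
  have d1 : HasDerivWithinAt (fun s => F (γ s)) (F' (X x)) (Set.Icc (0 : ℝ) 1) 0 := by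
    have hF'' : HasFDerivAt F F' (γ 0) := by rwa [hγ0]
    simpa [hγ0, Function.comp_def] using hF''.comp_hasDerivWithinAt (0 : ℝ) (hγ 0 m0)
  have d2 : HasDerivWithinAt (fun s => F (γ s)) (X (F x)) (Set.Icc (0 : ℝ) 1) 0 := by
    have := hδ 0 m0
    simp only [hδ0] at this
    exact this.congr_of_eventuallyEq heq (by simp [hγ0, hδ0])
  exact (uniqueDiffOn_Icc_zero_one 0 m0).eq_deriv _ d1 d2

/-- If `F` commutes infinitesimally with `X` near a common rest point, then their linear parts
commute. -/
lemma comp_eq_comp_of_eventually {X F : E → E} {L : E →L[ℝ] E}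
    (hX0 : X 0 = 0) (hX : HasFDerivAt X L 0) (hF0 : F 0 = 0) (hF : ContDiff ℝ 2 F)
    (h : ∀ᶠ x in 𝓝 (0 : E), fderiv ℝ F x (X x) = X (F x)) :
    (fderiv ℝ F 0).comp L = L.comp (fderiv ℝ F 0) := by
  have hd : DifferentiableAt ℝ F 0 := (hF.differentiable (by simp)) 0
  have hd2 : DifferentiableAt ℝ (fderiv ℝ F) 0 :=
    ((hF.fderiv_right (m := 1) (by norm_num)).differentiable (by simp)) 0
  have h1 := hd2.hasFDerivAt.clm_apply hX
  have hX' : HasFDerivAt X L (F 0) := by rwa [hF0]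
  have h2 := (hX'.comp (0 : E) hd.hasFDerivAt).congr_of_eventuallyEq h
  have := h1.unique h2
  simpa [hX0] using this

/-- Integral curves that start at `x` near a rest point satisfy `‖γ t‖ ≤ C ‖x‖` for `0 ≤ t ≤ 1`. -/
lemma exists_norm_integralCurve_le {X : E → E} {L : E →L[ℝ] E} (hX0 : X 0 = 0)
    (hX : HasFDerivAt X L 0) :
    ∃ C > 0, ∀ᶠ x in 𝓝 (0 : E), ∀ γ : ℝ → E, γ 0 = x →
      IsIntegralCurveOn γ (fun _ => X) (Set.Icc (0 : ℝ) 1) →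
        ∀ t ∈ Set.Icc (0 : ℝ) 1, ‖γ t‖ ≤ C * ‖x‖ := by
  obtain ⟨K, hK0, hK⟩ := hX.isBigO_sub.exists_pos
  rw [isBigOWith_iff] at hK
  simp only [hX0, sub_zero] at hK
  obtain ⟨ρ, hρ, hKρ⟩ := Metric.eventually_nhds_iff.1 hK
  refine ⟨Real.exp (K + 1), Real.exp_pos _, ?_⟩
  filter_upwards [Metric.ball_mem_nhds (0 : E) (div_pos hρ (Real.exp_pos (K + 1)))]
    with x hx γ hγ0 hγ t ht
  rw [mem_ball_zero_iff, lt_div_iff₀ (Real.exp_pos _)] at hx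
  -- The fence argument needs a strict inequality, so it is run with every height `η > ‖x‖`.
  have hz : ∀ η, ‖x‖ < η → η * Real.exp (K + 1) < ρ → ‖γ t‖ ≤ η * Real.exp ((K + 1) * t) := by
    intro η hxη hηρ
    have hη : 0 < η := (norm_nonneg x).trans_lt hxη
    refine image_norm_le_of_norm_deriv_right_lt_deriv_boundary' (f := γ)
      (f' := fun t => X (γ t)) (B := fun t => η * Real.exp ((K + 1) * t))
      (B' := fun t => η * (Real.exp ((K + 1) * t) * (K + 1)))
      (fun t ht => (hγ t ht).continuousWithinAt)
      (fun t ht => (hγ t (Set.Ico_subset_Icc_self ht)).mono_of_mem_nhdsWithin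
        (Icc_mem_nhdsGE_of_mem ht)) ?_ (by fun_prop) (fun t _ => ?_) (fun t ht he => ?_) ht
    · simp [hγ0, hxη.le]
    · exact ((((hasDerivAt_id t).const_mul (K + 1)).exp).const_mul η |>.congr_deriv
        (by simp)).hasDerivWithinAt
    · have hle : η * Real.exp ((K + 1) * t) ≤ η * Real.exp (K + 1) := by
        gcongr; nlinarith [ht.1, ht.2]
      have h1 := hKρ (y := γ t) (by rw [dist_zero_right, he]; linarith)
      have hp : 0 < η * Real.exp ((K + 1) * t) := by positivity
      rw [he] at h1
      nlinarith
  have hlim : ∀ s : ℝ, Tendsto (fun η : ℝ => η * s) (𝓝[>] ‖x‖) (𝓝 (‖x‖ * s)) := fun s =>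
    (Continuous.tendsto (by fun_prop) _).mono_left nhdsWithin_le_nhds
  calc ‖γ t‖ ≤ ‖x‖ * Real.exp ((K + 1) * t) := ge_of_tendsto (hlim _) (by
        filter_upwards [(hlim _).eventually_lt_const hx, self_mem_nhdsWithin] with η h1 h2
          using hz η h2 h1)
    _ ≤ ‖x‖ * Real.exp (K + 1) := by gcongr; nlinarith [ht.1, ht.2]
    _ = _ := mul_comm _ _

/-- The linear part of a time-one map acts as `exp β` on a linear form on which the linear part of
the vector field acts as `β`. -/
lemma fderiv_timeOne_apply {X F : E → E} {L A : E →L[ℝ] E} (hX0 : X 0 = 0)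
    (hX : HasFDerivAt X L 0) (hF0 : F 0 = 0) (hF : HasFDerivAt F A 0)
    (h : ∀ᶠ x in 𝓝 (0 : E), ∃ γ : ℝ → E, γ 0 = x ∧ γ 1 = F x ∧
      IsIntegralCurveOn γ (fun _ => X) (Set.Icc (0 : ℝ) 1))
    (φ : E →L[ℝ] ℝ) (β : ℝ) (hφ : ∀ v, φ (L v) = β * φ v) (v : E) :
    φ (A v) = Real.exp β * φ v := by
  obtain ⟨C, hC0, hC⟩ := exists_norm_integralCurve_le hX0 hX
  have ho : (fun x => Real.exp (-β) * φ (F x) - φ x) =o[𝓝 0] fun x : E => x := by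
    rw [isLittleO_iff]
    intro η hη
    set M : ℝ := Real.exp |β| * (‖φ‖ + 1) * C with hM
    have hMp : 0 < M := by positivity
    have hXo := hX.isLittleO
    rw [isLittleO_iff] at hXo
    simp only [hX0, sub_zero] at hXo
    obtain ⟨ρ, hρ, hXρ⟩ := Metric.eventually_nhds_iff.1 (hXo (div_pos hη hMp))
    filter_upwards [h, hC, Metric.ball_mem_nhds (0 : E) (div_pos hρ hC0)]
      with x ⟨γ, hγ0, hγ1, hγ⟩ hCx hx
    rw [mem_ball_zero_iff, lt_div_iff₀ hC0] at hx
    have hb := hCx γ hγ0 hγ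
    have hd : ∀ t ∈ Set.Icc (0 : ℝ) 1, HasDerivWithinAt (fun t => Real.exp (-β * t) * φ (γ t))
        (Real.exp (-β * t) * φ (X (γ t) - L (γ t))) (Set.Icc 0 1) t := by
      intro t ht
      have h1 : HasDerivWithinAt (fun t => φ (γ t)) (φ (X (γ t))) (Set.Icc 0 1) t :=
        φ.hasFDerivAt.comp_hasDerivWithinAt t (hγ t ht)
      have h2 : HasDerivWithinAt (fun t => Real.exp (-β * t)) (Real.exp (-β * t) * -β)
          (Set.Icc 0 1) t :=
        ((((hasDerivAt_id t).const_mul (-β)).exp).congr_deriv (by simp)).hasDerivWithinAt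
      refine (h2.mul h1).congr_deriv ?_
      rw [map_sub, hφ]; ring
    have hbd : ∀ t ∈ Set.Ico (0 : ℝ) 1,
        ‖Real.exp (-β * t) * φ (X (γ t) - L (γ t))‖ ≤ η * ‖x‖ := by
      intro t ht
      have hbt := hb t (Set.Ico_subset_Icc_self ht)
      have h1 : ‖X (γ t) - L (γ t)‖ ≤ η / M * ‖γ t‖ :=
        hXρ (by rw [dist_zero_right]; linarith)
      have h2 : Real.exp (-β * t) ≤ Real.exp |β| := by
        refine Real.exp_le_exp.2 ?_
        nlinarith [ht.1, ht.2, neg_abs_le β, abs_nonneg β]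
      rw [norm_mul, Real.norm_of_nonneg (Real.exp_pos _).le]
      calc Real.exp (-β * t) * ‖φ (X (γ t) - L (γ t))‖
          ≤ Real.exp |β| * ((‖φ‖ + 1) * (η / M * (C * ‖x‖))) := by
            gcongr
            refine (φ.le_opNorm _).trans ?_
            gcongr
            · linarith
            · exact h1.trans (by gcongr)
        _ = η * ‖x‖ := by rw [hM]; field_simp
    have := norm_image_sub_le_of_norm_deriv_le_segment_01' hd hbd
    simpa [hγ0, hγ1] using this
  have hd : HasFDerivAt (fun x => Real.exp (-β) * φ (F x) - φ x) (0 : E →L[ℝ] ℝ) 0 := by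
    rw [hasFDerivAt_iff_isLittleO]
    simpa [hF0] using ho
  have hd' := ((φ.hasFDerivAt.comp (0 : E) hF).const_mul (Real.exp (-β))).sub φ.hasFDerivAt
  have he := congrArg (fun T : E →L[ℝ] ℝ => T v) (hd'.unique hd)
  simp only [sub_apply, smul_apply,
    ContinuousLinearMap.comp_apply, smul_eq_mul, zero_apply] at he
  rw [Real.exp_neg] at he
  field_simp at he
  linarith

end Flow

/-! ### The example in coordinates -/

section Coordinates

variable {n : ℕ} (hn : 3 ≤ n)

lemma blockDiag_apply_castLE (P : Matrix (Fin 3) (Fin 3) ℝ) (d : Fin n → ℝ) (x : Rn n)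
    (k : Fin 3) :
    Matrix.toEuclideanCLM (n := Fin n) (𝕜 := ℝ) (blockDiag P d) x (Fin.castLE hn k)
      = ∑ l : Fin 3, P k l * x (Fin.castLE hn l) := by
  obtain ⟨m, rfl⟩ := Nat.exists_eq_add_of_le hn
  rw [Matrix.ofLp_toEuclideanCLM, Matrix.mulVec, dotProduct, Fin.sum_univ_add]
  have h1 : ∀ j : Fin m, blockDiag P d (Fin.castLE hn k) (Fin.natAdd 3 j) = 0 := by
    intro j
    have : Fin.castLE hn k ≠ Fin.natAdd 3 j := by
      intro h; have := congrArg Fin.val h; simp at this; omega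
    simp [blockDiag, this]
  simp only [h1, zero_mul, Finset.sum_const_zero, add_zero]
  refine Finset.sum_congr rfl fun l _ => ?_
  have : blockDiag P d (Fin.castLE hn k) (Fin.castAdd m l) = P k l := by
    simp [blockDiag]
  rw [this]; rfl

lemma blockDiag_apply_of_le (P : Matrix (Fin 3) (Fin 3) ℝ) (d : Fin n → ℝ) (x : Rn n)
    {i : Fin n} (hi : 3 ≤ (i : ℕ)) :
    Matrix.toEuclideanCLM (n := Fin n) (𝕜 := ℝ) (blockDiag P d) x i = d i * x i := by
  rw [Matrix.ofLp_toEuclideanCLM, Matrix.mulVec, dotProduct, Finset.sum_eq_single i]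
  · simp [blockDiag, not_lt.2 hi]
  · intro j _ hj
    simp [blockDiag, not_lt.2 hi, hj.symm]
  · simp

/-- The complex coordinate `z = x₁ - i x₂` on `ℝⁿ`. -/
noncomputable def planeCoord : Rn n →L[ℝ] ℂ :=
  (EuclideanSpace.proj (𝕜 := ℝ) (Fin.castLE hn 1)).smulRight (1 : ℂ) -
    (EuclideanSpace.proj (𝕜 := ℝ) (Fin.castLE hn 2)).smulRight Complex.I

/-- The embedding `ℂ → ℝⁿ` of the `(x₁, x₂)`-plane, a section of `planeCoord`. -/
noncomputable def planeIncl : ℂ →L[ℝ] Rn n :=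
  Complex.reCLM.smulRight (EuclideanSpace.single (Fin.castLE hn 1) (1 : ℝ)) -
    Complex.imCLM.smulRight (EuclideanSpace.single (Fin.castLE hn 2) (1 : ℝ))

/-- The eigenvalue `e^{1 + iπ/4}`. -/
noncomputable def rotEigenvalue : ℂ := Complex.exp (1 + Real.pi / 4 * Complex.I)

/-- The resonant polynomial `a |z|⁸ + 2 Re (b z⁸)` on `ℂ`. -/
noncomputable def resonantPoly (a : ℝ) (b z : ℂ) : ℝ :=
  a * Complex.normSq z ^ 4 + 2 * (b * z ^ 8).re

/-- The complex number `c` such that the differential of `resonantPoly a b` at `z` is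
`w ↦ Re (c w)`. -/
noncomputable def resonantGrad (a : ℝ) (b z : ℂ) : ℂ :=
  8 * a * (Complex.normSq z : ℂ) ^ 3 * (starRingEnd ℂ) z + 16 * b * z ^ 7

lemma planeCoord_apply (x : Rn n) :
    planeCoord hn x = x (Fin.castLE hn 1) - x (Fin.castLE hn 2) * Complex.I := by
  simp [planeCoord]

lemma planeCoord_re (x : Rn n) : (planeCoord hn x).re = x (Fin.castLE hn 1) := by
  simp [planeCoord_apply]

lemma planeCoord_im (x : Rn n) : (planeCoord hn x).im = -x (Fin.castLE hn 2) := by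
  simp [planeCoord_apply]

lemma planeIncl_apply (z : ℂ) (i : Fin n) :
    planeIncl hn z i = (if i = Fin.castLE hn 1 then z.re else 0)
      - (if i = Fin.castLE hn 2 then z.im else 0) := by
  simp [planeIncl]

lemma planeCoord_planeIncl (z : ℂ) : planeCoord hn (planeIncl hn z) = z := by
  apply Complex.ext <;> simp [planeCoord_re, planeCoord_im, planeIncl_apply]

lemma rotEigenvalue_eq :
    rotEigenvalue = ((√2 / 2 * Real.exp 1 : ℝ) : ℂ)
      + ((√2 / 2 * Real.exp 1 : ℝ) : ℂ) * Complex.I := by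
  rw [rotEigenvalue, Complex.exp_add]
  have h : (Real.pi / 4 * Complex.I : ℂ) = ((Real.pi / 4 : ℝ) : ℂ) * Complex.I := by push_cast; rfl
  rw [h, Complex.exp_mul_I, ← Complex.ofReal_cos, ← Complex.ofReal_sin, Real.cos_pi_div_four,
    Real.sin_pi_div_four]
  push_cast
  ring

lemma rotEigenvalue_pow_eight : rotEigenvalue ^ 8 = (Real.exp 8 : ℂ) := by
  rw [rotEigenvalue, ← Complex.exp_nat_mul]
  push_cast
  have : (8 * (1 + Real.pi / 4 * Complex.I) : ℂ) = 8 + 2 * Real.pi * Complex.I := by ring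
  rw [this, Complex.exp_add, Complex.exp_two_pi_mul_I, mul_one]

lemma normSq_rotEigenvalue : Complex.normSq rotEigenvalue = Real.exp 2 := by
  have h2 : √2 * √2 = 2 := Real.mul_self_sqrt (by norm_num)
  have h3 : Real.exp 2 = Real.exp 1 * Real.exp 1 := by rw [← Real.exp_add]; norm_num
  rw [rotEigenvalue_eq, Complex.normSq_add_mul_I, h3]
  linear_combination (Real.exp 1 * Real.exp 1 / 2) * h2

lemma planeCoord_blockDiag_blockA (d : Fin n → ℝ) (x : Rn n) :
    planeCoord hn (Matrix.toEuclideanCLM (n := Fin n) (𝕜 := ℝ) (blockDiag blockA d) x)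
      = rotEigenvalue * planeCoord hn x := by
  rw [rotEigenvalue_eq]
  generalize hs : √2 / 2 * Real.exp 1 = s
  apply Complex.ext
  · rw [planeCoord_re, blockDiag_apply_castLE, Complex.mul_re, planeCoord_re, planeCoord_im]
    simp [Fin.sum_univ_three, blockA, hs]
  · rw [planeCoord_im, blockDiag_apply_castLE, Complex.mul_im, planeCoord_re, planeCoord_im]
    simp [Fin.sum_univ_three, blockA, hs]

lemma blockDiag_blockA_apply_zero (d : Fin n → ℝ) (x : Rn n) :
    Matrix.toEuclideanCLM (n := Fin n) (𝕜 := ℝ) (blockDiag blockA d) x (Fin.castLE hn 0)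
      = Real.exp 8 * x (Fin.castLE hn 0) := by
  rw [blockDiag_apply_castLE]
  simp [Fin.sum_univ_three, blockA]

/-- A vector is determined by its coordinates `x₀`, `z = x₁ - i x₂` and `x₃, …, x_{n-1}`. -/
lemma ext_of_planeCoord {x y : Rn n} (h0 : x (Fin.castLE hn 0) = y (Fin.castLE hn 0))
    (hz : planeCoord hn x = planeCoord hn y) (h : ∀ i : Fin n, 3 ≤ (i : ℕ) → x i = y i) :
    x = y := by
  ext i
  rcases lt_or_ge (i : ℕ) 3 with hi | hi
  · have h1 := congrArg Complex.re hz
    have h2 := congrArg Complex.im hz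
    rw [planeCoord_re, planeCoord_re] at h1
    rw [planeCoord_im, planeCoord_im, neg_inj] at h2
    obtain ⟨k, rfl⟩ : ∃ k : Fin 3, i = Fin.castLE hn k := ⟨⟨i, hi⟩, rfl⟩
    fin_cases k
    exacts [h0, h1, h2]
  · exact h i hi

lemma planeIncl_apply_of_ne (z : ℂ) {i : Fin n} (h1 : (i : ℕ) ≠ 1) (h2 : (i : ℕ) ≠ 2) :
    planeIncl hn z i = 0 := by
  rw [planeIncl_apply, if_neg (fun h => h1 (by simp [h])), if_neg (fun h => h2 (by simp [h])),
    sub_zero]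

lemma blockDiag_blockA_planeIncl (d : Fin n → ℝ) (z : ℂ) :
    Matrix.toEuclideanCLM (n := Fin n) (𝕜 := ℝ) (blockDiag blockA d) (planeIncl hn z)
      = planeIncl hn (rotEigenvalue * z) := by
  refine ext_of_planeCoord hn ?_ ?_ fun i hi => ?_
  · rw [blockDiag_blockA_apply_zero, planeIncl_apply_of_ne hn _ (by simp) (by simp),
      planeIncl_apply_of_ne hn _ (by simp) (by simp), mul_zero]
  · rw [planeCoord_blockDiag_blockA, planeCoord_planeIncl, planeCoord_planeIncl]
  · rw [blockDiag_apply_of_le _ _ _ hi, planeIncl_apply_of_ne hn _ (by omega) (by omega),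
      planeIncl_apply_of_ne hn _ (by omega) (by omega), mul_zero]

lemma resonantTerm_eq (a : ℝ) (b : ℂ) (x : Rn n) :
    resonantTerm hn a b x = resonantPoly a b (planeCoord hn x) •
      EuclideanSpace.single (Fin.castLE hn 0) (1 : ℝ) := by
  have h : Complex.normSq (planeCoord hn x)
      = x (Fin.castLE hn 1) ^ 2 + x (Fin.castLE hn 2) ^ 2 := by
    rw [Complex.normSq_apply, planeCoord_re, planeCoord_im]; ring
  rw [resonantTerm, resonantPoly, h, planeCoord_apply]
  ext i
  rw [PiLp.smul_apply, PiLp.single_apply, PiLp.single_apply, smul_eq_mul,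
    mul_ite, mul_one, mul_zero]
  rfl

lemma planeCoord_single_of_ne {i : Fin n} (h1 : (i : ℕ) ≠ 1) (h2 : (i : ℕ) ≠ 2) (c : ℝ) :
    planeCoord hn (EuclideanSpace.single i c) = 0 := by
  have e1 : Fin.castLE hn 1 ≠ i := fun h => h1 (by simp [← h])
  have e2 : Fin.castLE hn 2 ≠ i := fun h => h2 (by simp [← h])
  simp [planeCoord_apply, e1, e2]

lemma hasFDerivAt_resonantPoly (a : ℝ) (b z : ℂ) :
    HasFDerivAt (resonantPoly a b)
      (Complex.reCLM.comp (ContinuousLinearMap.mul ℝ ℂ (resonantGrad a b z))) z := by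
  have h1 : HasFDerivAt (fun z : ℂ => Complex.normSq z)
      ((2 * z.re) • Complex.reCLM + (2 * z.im) • Complex.imCLM) z := by
    have := (Complex.reCLM.hasFDerivAt (x := z)).mul (Complex.reCLM.hasFDerivAt (x := z))
      |>.add ((Complex.imCLM.hasFDerivAt (x := z)).mul (Complex.imCLM.hasFDerivAt (x := z)))
    refine (this.congr_fderiv ?_)
    ext w
    simp
    ring
  have h2 : HasFDerivAt (fun z : ℂ => (b * z ^ 8).re) _ z :=
    Complex.reCLM.hasFDerivAt.comp z
      (((hasDerivAt_pow 8 z).const_mul b).hasFDerivAt.restrictScalars ℝ)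
  refine (((h1.pow 4).const_mul a).add (h2.const_mul 2)).congr_fderiv ?_
  have h3 : ((Complex.normSq z : ℂ) ^ 3).re = Complex.normSq z ^ 3 := by
    rw [← Complex.ofReal_pow, Complex.ofReal_re]
  have h4 : ((Complex.normSq z : ℂ) ^ 3).im = 0 := by
    rw [← Complex.ofReal_pow, Complex.ofReal_im]
  ext w
  simp [resonantGrad, h3, h4]
  ring

lemma contDiff_resonantPoly (a : ℝ) (b : ℂ) {r : WithTop ℕ∞} : ContDiff ℝ r (resonantPoly a b) := by
  have h1 : ContDiff ℝ r (fun z : ℂ => Complex.normSq z) := by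
    have : (fun z : ℂ => Complex.normSq z) = fun z => Complex.reCLM z * Complex.reCLM z
      + Complex.imCLM z * Complex.imCLM z := by ext z; simp [Complex.normSq_apply]
    rw [this]
    exact (Complex.reCLM.contDiff.mul Complex.reCLM.contDiff).add
      (Complex.imCLM.contDiff.mul Complex.imCLM.contDiff)
  have h2 : ContDiff ℝ r (fun z : ℂ => (b * z ^ 8).re) :=
    Complex.reCLM.contDiff.comp (contDiff_const.mul (contDiff_id.pow 8))
  exact (contDiff_const.mul (h1.pow 4)).add (contDiff_const.mul h2)

lemma re_mul_ofReal_mul (b z : ℂ) (r : ℝ) : (b * (r * z)).re = r * (b * z).re := by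
  rw [mul_left_comm, Complex.re_ofReal_mul]

lemma resonantPoly_smul (a : ℝ) (b z : ℂ) (ε : ℝ) :
    resonantPoly a b (ε * z) = ε ^ 8 * resonantPoly a b z := by
  rw [resonantPoly, resonantPoly, map_mul, Complex.normSq_ofReal, mul_pow (ε : ℂ),
    ← Complex.ofReal_pow, re_mul_ofReal_mul]
  ring

lemma resonantGrad_smul (a : ℝ) (b z : ℂ) (ε : ℝ) :
    resonantGrad a b (ε * z) = (ε ^ 7 : ℝ) * resonantGrad a b z := by
  simp only [resonantGrad, map_mul, Complex.normSq_ofReal, Complex.conj_ofReal]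
  push_cast
  ring

lemma resonantPoly_rotEigenvalue_mul (a : ℝ) (b z : ℂ) :
    resonantPoly a b (rotEigenvalue * z) = Real.exp 8 * resonantPoly a b z := by
  have h : Real.exp 2 ^ 4 = Real.exp 8 := by rw [← Real.exp_nat_mul]; norm_num
  rw [resonantPoly, resonantPoly, map_mul, normSq_rotEigenvalue, mul_pow, mul_pow, h,
    rotEigenvalue_pow_eight, re_mul_ofReal_mul]
  ring

lemma resonantGrad_rotEigenvalue_mul (a : ℝ) (b z : ℂ) :
    resonantGrad a b (rotEigenvalue * z) * rotEigenvalue = Real.exp 8 * resonantGrad a b z := by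
  have h : (Real.exp 2 : ℂ) ^ 4 = Real.exp 8 := by
    rw [← Complex.ofReal_pow, ← Real.exp_nat_mul]; norm_num
  have h1 : (starRingEnd ℂ) rotEigenvalue * rotEigenvalue = (Real.exp 2 : ℂ) := by
    rw [mul_comm, Complex.mul_conj, normSq_rotEigenvalue]
  simp only [resonantGrad, map_mul, normSq_rotEigenvalue]
  push_cast [-Complex.ofReal_exp]
  linear_combination 8 * a * (Real.exp 2 : ℂ) ^ 3 * (Complex.normSq z : ℂ) ^ 3 *
    (starRingEnd ℂ) z * h1 + 8 * a * (Complex.normSq z : ℂ) ^ 3 * (starRingEnd ℂ) z * h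
    + 16 * b * z ^ 7 * rotEigenvalue_pow_eight

/-- If the derivative of the polynomial along the field `z ↦ β z` is `α` times the polynomial, then
`8 β = α`: on the unit circle the terms in `z⁸` and in `|z|⁸` separate, as `z⁸` takes every value. -/
lemma eight_mul_eq_of_resonantGrad {a α : ℝ} {b β : ℂ} (hb : b ≠ 0)
    (h : ∀ z, (resonantGrad a b z * (β * z)).re = α * resonantPoly a b z) : 8 * β = α := by
  set w : ℂ := 2 * b * (8 * β - α) with hw
  set c : ℝ := 8 * a * β.re - α * a with hc
  have key : ∀ u : ℂ, ‖u‖ = 1 → c + (w * u).re = 0 := by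
    intro u hu
    obtain ⟨z, hz⟩ := IsAlgClosed.exists_pow_nat_eq u (n := 8) (by norm_num)
    have hn : ‖z‖ = 1 := by
      have : ‖z‖ ^ 8 = 1 := by rw [← norm_pow, hz, hu]
      exact (pow_eq_one_iff_of_nonneg (norm_nonneg z) (by norm_num)).1 this
    have hs : Complex.normSq z = 1 := by rw [Complex.normSq_eq_norm_sq, hn, one_pow]
    have hs' : (starRingEnd ℂ) z * z = 1 := by rw [mul_comm, Complex.mul_conj, hs, Complex.ofReal_one]
    have h1 := h z
    have e1 : resonantGrad a b z * (β * z) = ((8 * a : ℝ) : ℂ) * β + 16 * b * β * u := by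
      rw [resonantGrad, hs, ← hz]
      push_cast
      linear_combination 8 * a * β * hs'
    have e2 : w * u = 16 * b * β * u - ((2 * α : ℝ) : ℂ) * (b * u) := by
      rw [hw]; push_cast; ring
    rw [e1, resonantPoly, hs, hz, Complex.add_re, Complex.re_ofReal_mul] at h1
    rw [e2, Complex.sub_re, Complex.re_ofReal_mul, hc]
    linarith
  have k1 := key 1 (by simp)
  have k2 := key (-1) (by simp)
  have k3 := key Complex.I (by simp)
  simp at k1 k2 k3
  have hw0 : w = 0 := by
    apply Complex.ext <;> simp <;> linarith
  have : 8 * β - (α : ℂ) = 0 := by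
    rcases mul_eq_zero.1 hw0 with h0 | h0
    · exact absurd h0 (by simpa using hb)
    · exact h0
  exact sub_eq_zero.1 this

end Coordinates

/-! ### The obstruction to an embedding vector field -/

/-- Expansion to order `8` along the ray `ε v` of one component of the relation `DF(x) X(x) = X(F(x))`,
where `F (ε v) = ε w + ε ^ 8 q e`. The Taylor coefficients of `X` of intermediate order do not
contribute to the right-hand side. -/
lemma scaling_isLittleO {E : Type*} [NormedAddCommGroup E] [NormedSpace ℝ E] {X : E → E}
    {L : E →L[ℝ] E} (hX0 : X 0 = 0) (hX : HasStrictFDerivAt X L 0) (χ ψ : E →L[ℝ] ℝ)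
    (v w e : E) (c q : ℝ)
    (h : ∀ᶠ ε : ℝ in 𝓝 0,
      c * χ (X (ε • v)) + ε ^ 7 * ψ (X (ε • v)) = χ (X (ε • w + (ε ^ 8 * q) • e))) :
    (fun ε : ℝ => χ (X (ε • w)) - c * χ (X (ε • v)) - (ψ (L v) - q * χ (L e)) * ε ^ 8)
      =o[𝓝 0] fun ε => ε ^ 8 := by
  have h1 : (fun ε : ℝ => X (ε • v) - ε • L v) =o[𝓝 0] fun ε => ε := by
    have ht : Tendsto (fun ε : ℝ => ε • v) (𝓝 0) (𝓝 0) := by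
      have : Continuous fun ε : ℝ => ε • v := by fun_prop
      simpa using this.tendsto 0
    have := hX.hasFDerivAt.isLittleO.comp_tendsto ht
    simp only [hX0, sub_zero, Function.comp_def, map_smul] at this
    refine this.trans_isBigO (IsBigO.of_bound ‖v‖ (Eventually.of_forall fun ε => ?_))
    rw [norm_smul, mul_comm]
  have h2 : (fun ε : ℝ => X (ε • w + (ε ^ 8 * q) • e) - X (ε • w) - (ε ^ 8 * q) • L e)
      =o[𝓝 0] fun ε => ε ^ 8 := by
    have ht : Tendsto (fun ε : ℝ => (ε • w + (ε ^ 8 * q) • e, ε • w)) (𝓝 0) (𝓝 ((0 : E), (0 : E))) := by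
      have : Continuous fun ε : ℝ => (ε • w + (ε ^ 8 * q) • e, ε • w) := by fun_prop
      simpa using this.tendsto 0
    have := hX.isLittleO.comp_tendsto ht
    simp only [Function.comp_def, add_sub_cancel_left, map_smul] at this
    refine this.trans_isBigO (IsBigO.of_bound (‖q‖ * ‖e‖) (Eventually.of_forall fun ε => ?_))
    rw [norm_smul, norm_mul]
    exact le_of_eq (by ring)
  have h3 : (fun ε : ℝ => ε ^ 7 * ψ (X (ε • v) - ε • L v)) =o[𝓝 0] fun ε => ε ^ 8 :=
    ((isBigO_refl (fun ε : ℝ => ε ^ 7) (𝓝 0)).mul_isLittleO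
      ((ψ.isBigO_comp _ _).trans_isLittleO h1)).congr_right fun ε => by ring
  refine (h3.sub ((χ.isBigO_comp _ _).trans_isLittleO h2)).congr' ?_ EventuallyEq.rfl
  filter_upwards [h] with ε hε
  simp only [map_sub, map_smul, smul_eq_mul, ← hε]
  ring

section

variable {n : ℕ} (hn : 3 ≤ n)

lemma rotEigenvalue_im_ne_zero : rotEigenvalue.im ≠ 0 := by
  rw [rotEigenvalue_eq, Complex.add_im, Complex.ofReal_im, Complex.im_ofReal_mul, Complex.I_im]
  positivity

lemma eq_zero_of_real_mul_eq_rotEigenvalue_mul {c : ℝ} {w : ℂ} (h : c * w = rotEigenvalue * w) :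
    w = 0 := by
  by_contra hw
  have := mul_right_cancel₀ hw h
  exact rotEigenvalue_im_ne_zero (by rw [← this, Complex.ofReal_im])

/-- A linear map that commutes with `blockDiag blockA d` acts on the complex coordinate `z` as the
multiplication by a complex number: the eigenvalues off the `z`-plane are real, and the one on it is
not. -/
lemma exists_planeCoord_apply_eq (d : Fin n → ℝ) (L : Rn n →L[ℝ] Rn n)
    (hL : ∀ v, Matrix.toEuclideanCLM (n := Fin n) (𝕜 := ℝ) (blockDiag blockA d) (L v)
      = L (Matrix.toEuclideanCLM (n := Fin n) (𝕜 := ℝ) (blockDiag blockA d) v)) :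
    ∃ β : ℂ, ∀ v, planeCoord hn (L v) = β * planeCoord hn v := by
  have hm : ∀ v, planeCoord hn (L (Matrix.toEuclideanCLM (n := Fin n) (𝕜 := ℝ)
      (blockDiag blockA d) v)) = rotEigenvalue * planeCoord hn (L v) := fun v => by
    rw [← hL, planeCoord_blockDiag_blockA]
  -- On the plane, `z ↦ planeCoord (L z)` commutes with `rotEigenvalue`, hence with `i`.
  have hI : planeCoord hn (L (planeIncl hn Complex.I))
      = planeCoord hn (L (planeIncl hn 1)) * Complex.I := by
    have h1 := hm (planeIncl hn 1)
    have hs : (√2 / 2 * Real.exp 1 : ℝ) ≠ 0 := by positivity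
    rw [blockDiag_blockA_planeIncl, mul_one, rotEigenvalue_eq] at h1
    generalize (√2 / 2 * Real.exp 1 : ℝ) = s at h1 hs
    have h2 : ((s : ℂ) + s * Complex.I) = s • (1 : ℂ) + s • Complex.I := by simp
    rw [h2, map_add, map_add, map_add, map_smul, map_smul, map_smul,
      map_smul, map_smul, map_smul] at h1
    simp only [Complex.real_smul] at h1
    have hs' : (s : ℂ) ≠ 0 := by exact_mod_cast hs
    refine mul_left_cancel₀ hs' ?_
    linear_combination h1
  have hreal : ∀ i : Fin n, (i : ℕ) ≠ 1 → (i : ℕ) ≠ 2 →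
      planeCoord hn (L (EuclideanSpace.single i 1)) = 0 := by
    intro i h1 h2
    have hv : ∃ c : ℝ, Matrix.toEuclideanCLM (n := Fin n) (𝕜 := ℝ) (blockDiag blockA d)
        (EuclideanSpace.single i (1 : ℝ)) = c • EuclideanSpace.single i (1 : ℝ) := by
      refine ⟨if (i : ℕ) = 0 then Real.exp 8 else d i, ext_of_planeCoord hn ?_ ?_ fun j hj => ?_⟩
      · rw [blockDiag_blockA_apply_zero]
        by_cases h : Fin.castLE hn 0 = i
        · subst h; simp
        · rw [PiLp.smul_apply]
          simp [h]
      · rw [planeCoord_blockDiag_blockA, map_smul, planeCoord_single_of_ne hn h1 h2]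
        simp
      · rw [blockDiag_apply_of_le _ _ _ hj]
        by_cases h : j = i
        · subst h
          simp [show (j : ℕ) ≠ 0 by omega]
        · rw [PiLp.smul_apply]
          simp [h]
    obtain ⟨c, hc⟩ := hv
    have := hm (EuclideanSpace.single i 1)
    rw [hc, map_smul, map_smul, Complex.real_smul] at this
    exact eq_zero_of_real_mul_eq_rotEigenvalue_mul this
  refine ⟨planeCoord hn (L (planeIncl hn 1)), fun v => ?_⟩
  have hdec : planeCoord hn (L (v - planeIncl hn (planeCoord hn v))) = 0 := by
    have hsum : v - planeIncl hn (planeCoord hn v) = ∑ i : Fin n,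
        (v - planeIncl hn (planeCoord hn v)) i • EuclideanSpace.single i (1 : ℝ) := by
      ext j; simp [Finset.sum_apply, Pi.single_apply]
    rw [hsum, map_sum, map_sum]
    refine Finset.sum_eq_zero fun i _ => ?_
    rw [map_smul, map_smul]
    by_cases h1 : (i : ℕ) = 1
    · have : i = Fin.castLE hn 1 := Fin.ext h1
      subst this
      simp [planeIncl_apply, planeCoord_re]
    by_cases h2 : (i : ℕ) = 2
    · have : i = Fin.castLE hn 2 := Fin.ext h2
      subst this
      simp [planeIncl_apply, planeCoord_im]
    rw [hreal i h1 h2, smul_zero]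
  have hz : planeIncl hn (planeCoord hn v) = (planeCoord hn v).re • planeIncl hn 1
      + (planeCoord hn v).im • planeIncl hn Complex.I := by
    rw [← map_smul, ← map_smul, ← map_add]
    congr 1
    simp
  rw [map_sub, map_sub, sub_eq_zero, hz, map_add, map_add, map_smul, map_smul, map_smul, map_smul,
    hI] at hdec
  rw [hdec, Complex.real_smul, Complex.real_smul]
  conv_rhs => rw [← Complex.re_add_im (planeCoord hn v)]
  ring

lemma perturbed_eq (d : Fin n → ℝ) (a : ℝ) (b : ℂ) (x : Rn n) :
    perturbed (blockDiag blockA d) (resonantTerm hn a b) x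
      = Matrix.toEuclideanCLM (n := Fin n) (𝕜 := ℝ) (blockDiag blockA d) x
        + resonantPoly a b (planeCoord hn x) • EuclideanSpace.single (Fin.castLE hn 0) (1 : ℝ) := by
  rw [perturbed, resonantTerm_eq]

lemma contDiff_perturbed (d : Fin n → ℝ) (a : ℝ) (b : ℂ) {r : WithTop ℕ∞} :
    ContDiff ℝ r (perturbed (blockDiag blockA d) (resonantTerm hn a b)) := by
  rw [funext (perturbed_eq hn d a b)]
  exact (ContinuousLinearMap.contDiff _).add
    (((contDiff_resonantPoly a b).comp (planeCoord hn).contDiff).smul contDiff_const)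

lemma hasFDerivAt_perturbed (d : Fin n → ℝ) (a : ℝ) (b : ℂ) (x : Rn n) :
    HasFDerivAt (perturbed (blockDiag blockA d) (resonantTerm hn a b))
      (Matrix.toEuclideanCLM (n := Fin n) (𝕜 := ℝ) (blockDiag blockA d)
        + ((Complex.reCLM.comp (ContinuousLinearMap.mul ℝ ℂ
            (resonantGrad a b (planeCoord hn x)))).comp (planeCoord hn)).smulRight
          (EuclideanSpace.single (Fin.castLE hn 0) (1 : ℝ))) x := by
  rw [funext (perturbed_eq hn d a b)]
  exact (ContinuousLinearMap.hasFDerivAt _).add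
    (((hasFDerivAt_resonantPoly a b _).comp x (planeCoord hn).hasFDerivAt).smul_const _)

lemma fderiv_perturbed_apply (d : Fin n → ℝ) (a : ℝ) (b : ℂ) (x v : Rn n) :
    fderiv ℝ (perturbed (blockDiag blockA d) (resonantTerm hn a b)) x v
      = Matrix.toEuclideanCLM (n := Fin n) (𝕜 := ℝ) (blockDiag blockA d) v
        + (resonantGrad a b (planeCoord hn x) * planeCoord hn v).re •
          EuclideanSpace.single (Fin.castLE hn 0) (1 : ℝ) := by
  rw [(hasFDerivAt_perturbed hn d a b x).fderiv]
  simp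

lemma perturbed_zero (d : Fin n → ℝ) (a : ℝ) (b : ℂ) :
    perturbed (blockDiag blockA d) (resonantTerm hn a b) 0 = 0 := by
  rw [perturbed_eq]
  simp [resonantPoly]

lemma fderiv_perturbed_zero (d : Fin n → ℝ) (a : ℝ) (b : ℂ) :
    fderiv ℝ (perturbed (blockDiag blockA d) (resonantTerm hn a b)) 0
      = Matrix.toEuclideanCLM (n := Fin n) (𝕜 := ℝ) (blockDiag blockA d) := by
  ext1 v
  rw [fderiv_perturbed_apply]
  simp [resonantGrad]

/-- The resonant coefficient of the commutation relation: since the eight-fold iterate of the linear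
part is a homothety of the `z`-plane, the derivative of the resonant polynomial along the linear part
of `X` has to be a multiple of that polynomial. -/
lemma resonantGrad_eq_of_eventually (d : Fin n → ℝ) (a : ℝ) (b : ℂ) {X : Rn n → Rn n}
    {L : Rn n →L[ℝ] Rn n} (hX0 : X 0 = 0) (hX : ContDiffAt ℝ ∞ X 0) (hL : HasFDerivAt X L 0)
    (h : ∀ᶠ x in 𝓝 0, fderiv ℝ (perturbed (blockDiag blockA d) (resonantTerm hn a b)) x (X x)
      = X (perturbed (blockDiag blockA d) (resonantTerm hn a b) x))
    {β : ℂ} (hβ : ∀ v, planeCoord hn (L v) = β * planeCoord hn v) (z : ℂ) :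
    (resonantGrad a b z * (β * z)).re
      = L (EuclideanSpace.single (Fin.castLE hn 0) 1) (Fin.castLE hn 0) * resonantPoly a b z := by
  set α : ℝ := L (EuclideanSpace.single (Fin.castLE hn 0) 1) (Fin.castLE hn 0) with hα
  set K : ℂ → ℝ := fun z => (resonantGrad a b z * (β * z)).re - α * resonantPoly a b z with hK
  set g : ℂ → ℝ → ℝ := fun z ε => X (ε • planeIncl hn z) (Fin.castLE hn 0) with hg
  have hXs : HasStrictFDerivAt X L 0 := hX.hasStrictFDerivAt' hL (by simp)
  have hstep : ∀ z : ℂ, (fun ε : ℝ => g (rotEigenvalue * z) ε - Real.exp 8 * g z ε - K z * ε ^ 8)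
      =o[𝓝 0] fun ε => ε ^ 8 := by
    intro z
    have := scaling_isLittleO hX0 hXs (EuclideanSpace.proj (𝕜 := ℝ) (Fin.castLE hn 0))
      ((Complex.reCLM.comp (ContinuousLinearMap.mul ℝ ℂ (resonantGrad a b z))).comp (planeCoord hn))
      (planeIncl hn z) (planeIncl hn (rotEigenvalue * z))
      (EuclideanSpace.single (Fin.castLE hn 0) (1 : ℝ)) (Real.exp 8) (resonantPoly a b z) ?_
    · refine this.congr_left fun ε => ?_
      simp only [hg, hK, PiLp.proj_apply, ContinuousLinearMap.comp_apply, hβ,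
        planeCoord_planeIncl, ContinuousLinearMap.mul_apply', Complex.reCLM_apply, ← hα]
      ring
    · have ht : Tendsto (fun ε : ℝ => ε • planeIncl hn z) (𝓝 0) (𝓝 0) := by
        have : Continuous fun ε : ℝ => ε • planeIncl hn z := by fun_prop
        simpa using this.tendsto 0
      filter_upwards [ht.eventually h] with ε hε
      rw [fderiv_perturbed_apply, perturbed_eq, map_smul, map_smul, planeCoord_planeIncl,
        blockDiag_blockA_planeIncl, Complex.real_smul, resonantGrad_smul, resonantPoly_smul] at hε
      have h0 := congrArg (fun x : Rn n => x (Fin.castLE hn 0)) hε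
      simp only [PiLp.add_apply, blockDiag_blockA_apply_zero, PiLp.smul_apply,
        PiLp.single_apply, if_true, smul_eq_mul, mul_one, mul_assoc,
        Complex.re_ofReal_mul] at h0
      simpa [mul_assoc] using h0
  have hKr : ∀ z, K (rotEigenvalue * z) = Real.exp 8 * K z := by
    intro z
    have e1 : resonantGrad a b (rotEigenvalue * z) * (β * (rotEigenvalue * z))
        = (Real.exp 8 : ℂ) * (resonantGrad a b z * (β * z)) := by
      linear_combination β * z * resonantGrad_rotEigenvalue_mul a b z
    simp only [hK]
    rw [e1, resonantPoly_rotEigenvalue_mul, Complex.re_ofReal_mul]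
    ring
  have hiter : ∀ (m : ℕ) (z : ℂ), (fun ε : ℝ => Real.exp 8 * (g (rotEigenvalue ^ m * z) ε
      - Real.exp 8 ^ m * g z ε) - m * Real.exp 8 ^ m * K z * ε ^ 8) =o[𝓝 0] fun ε => ε ^ 8 := by
    intro m
    induction m with
    | zero => intro z; simp
    | succ m ih =>
      intro z
      refine ((ih (rotEigenvalue * z)).add
        ((hstep z).const_mul_left (Real.exp 8 ^ (m + 1)))).congr_left fun ε => ?_
      rw [hKr, pow_succ rotEigenvalue, mul_assoc (rotEigenvalue ^ m)]
      push_cast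
      ring
  have h8 := hiter 8 z
  rw [rotEigenvalue_pow_eight] at h8
  have hgs : ∀ ε, g ((Real.exp 8 : ℂ) * z) ε = g z (Real.exp 8 * ε) := by
    intro ε
    simp only [hg]
    rw [← Complex.real_smul, map_smul, smul_smul, mul_comm ε]
  simp only [hgs] at h8
  have hgC : ContDiffAt ℝ (8 : ℕ) (g z) 0 := by
    have h1 : ContDiffAt ℝ (8 : ℕ) X ((0 : ℝ) • planeIncl hn z) := by
      rw [zero_smul]; exact hX.of_le (WithTop.coe_le_coe.2 le_top)
    exact (EuclideanSpace.proj (𝕜 := ℝ) (Fin.castLE hn 0)).contDiff.contDiffAt.comp (0 : ℝ)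
      (h1.comp (0 : ℝ) (f := fun ε : ℝ => ε • planeIncl hn z) (by fun_prop))
  have hne : Real.exp 8 ≠ 0 := (Real.exp_pos 8).ne'
  have := eq_zero_of_scaling_isLittleO hgC (Real.exp 8)
    ((Real.exp 8)⁻¹ * (8 * Real.exp 8 ^ 8 * K z)) ?_
  · have hK0 : K z = 0 := by
      have h2 : (Real.exp 8)⁻¹ * (8 * Real.exp 8 ^ 8) ≠ 0 := by positivity
      rw [← mul_assoc] at this
      exact (mul_eq_zero.1 this).resolve_left h2
    exact sub_eq_zero.1 hK0
  · refine (h8.const_mul_left (Real.exp 8)⁻¹).congr_left fun ε => ?_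
    field_simp
    push_cast
    ring

/-- If `b ≠ 0`, the map `x ↦ A x + f x` has no smooth embedding vector field: such a field `X` would
act on `z` by a multiplication by `β` with `8 β` real, so its flow would not rotate the `z`-plane. -/
theorem not_exists_isEmbeddingVectorField (d : Fin n → ℝ) (hd : ∀ i : Fin n, 3 ≤ (i : ℕ) → 1 < d i)
    (a : ℝ) {b : ℂ} (hb : b ≠ 0) :
    ¬ ∃ X : Rn n → Rn n, IsEmbeddingVectorField ∞ X
      (perturbed (blockDiag blockA d) (resonantTerm hn a b)) := by
  rintro ⟨X, U, hU, h0U, hXU, h⟩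
  set A := Matrix.toEuclideanCLM (n := Fin n) (𝕜 := ℝ) (blockDiag blockA d) with hA
  set F := perturbed (blockDiag blockA d) (resonantTerm hn a b) with hF
  have hFC : ContDiff ℝ 2 F := contDiff_perturbed hn d a b
  have hF0 : F 0 = 0 := perturbed_zero hn d a b
  have hFd : Differentiable ℝ F := hFC.differentiable (by simp)
  have hFA : fderiv ℝ F 0 = A := fderiv_perturbed_zero hn d a b
  have hX : ContDiffAt ℝ ∞ X 0 := hXU.contDiffAt (hU.mem_nhds h0U)
  have hcomm : ∀ᶠ x in 𝓝 0, fderiv ℝ F x (X x) = X (F x) := by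
    filter_upwards [eventually_hasFDerivAt_apply_eq hU (hXU.of_le (by simp))
      hFC.continuous.continuousAt hF0 h] with x hx using hx _ (hFd x).hasFDerivAt
  -- The origin is a rest point of `X`, because `1` is not an eigenvalue of `A`.
  have hX0 : X 0 = 0 := by
    have h1 := hcomm.self_of_nhds
    rw [hF0, hFA] at h1
    refine ext_of_planeCoord hn ?_ ?_ fun i hi => ?_
    · have h2 := congrArg (fun x : Rn n => x (Fin.castLE hn 0)) h1
      simp only [hA, blockDiag_blockA_apply_zero] at h2
      have h3 : (1 : ℝ) < Real.exp 8 := Real.one_lt_exp_iff.2 (by norm_num)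
      have h4 : (Real.exp 8 - 1) * X 0 (Fin.castLE hn 0) = 0 := by linarith
      exact (mul_eq_zero.1 h4).resolve_left (by linarith)
    · have h2 := congrArg (planeCoord hn) h1
      rw [hA, planeCoord_blockDiag_blockA] at h2
      rw [map_zero]
      exact eq_zero_of_real_mul_eq_rotEigenvalue_mul (c := 1) (by rw [h2]; simp)
    · have h2 := congrArg (fun x : Rn n => x i) h1
      simp only [hA, blockDiag_apply_of_le _ _ _ hi] at h2
      have h4 : (d i - 1) * X 0 i = 0 := by linarith
      exact (mul_eq_zero.1 h4).resolve_left (by linarith [hd i hi])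
  have hL : HasFDerivAt X (fderiv ℝ X 0) 0 := (hX.differentiableAt (by simp)).hasFDerivAt
  set L := fderiv ℝ X 0 with hLdef
  have hAL := comp_eq_comp_of_eventually hX0 hL hF0 hFC hcomm
  rw [hFA] at hAL
  obtain ⟨β, hβ⟩ := exists_planeCoord_apply_eq hn d L fun v => by
    simpa using congrArg (fun T : Rn n →L[ℝ] Rn n => T v) hAL
  have h8 := eight_mul_eq_of_resonantGrad hb
    (resonantGrad_eq_of_eventually hn d a b hX0 hX hL hcomm hβ)
  have him : β.im = 0 := by
    have := congrArg Complex.im h8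
    simpa using this
  have hβr : β = (β.re : ℂ) := Complex.ext rfl (by simp [him])
  have hφ := fderiv_timeOne_apply hX0 hL hF0 (hFA ▸ (hFd 0).hasFDerivAt)
    (h.mono fun x ⟨γ, h0, h1, _, hγ⟩ => ⟨γ, h0, h1, hγ⟩) (Complex.reCLM.comp (planeCoord hn)) β.re
    (fun v => by
      simp only [ContinuousLinearMap.comp_apply, Complex.reCLM_apply]
      rw [hβ, hβr, Complex.re_ofReal_mul, Complex.ofReal_re]) (planeIncl hn Complex.I)
  simp only [ContinuousLinearMap.comp_apply, Complex.reCLM_apply, hA, planeCoord_blockDiag_blockA,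
    planeCoord_planeIncl, Complex.mul_I_re, Complex.I_re, mul_zero, neg_eq_zero] at hφ
  exact rotEigenvalue_im_ne_zero hφ

end

/-! ### Spectrum and exponential of the block diagonal matrices -/

section Matrices

open Matrix

lemma blockDiag_eq_submatrix_fromBlocks {m : ℕ} (P : Matrix (Fin 3) (Fin 3) ℝ)
    (d : Fin (3 + m) → ℝ) :
    blockDiag P d = (fromBlocks P 0 0 (diagonal fun j => d (Fin.natAdd 3 j))).submatrix
      finSumFinEquiv.symm finSumFinEquiv.symm := by
  ext i j
  induction i using Fin.addCases with
  | left i =>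
    induction j using Fin.addCases with
    | left j => simp [blockDiag]
    | right j =>
      have : Fin.castAdd m i ≠ Fin.natAdd 3 j := by
        intro h; have := congrArg Fin.val h; simp at this; omega
      simp [blockDiag, this]
  | right i =>
    induction j using Fin.addCases with
    | left j =>
      have : Fin.natAdd 3 i ≠ Fin.castAdd m j := by
        intro h; have := congrArg Fin.val h; simp at this; omega
      simp [blockDiag, this]
    | right j => simp [blockDiag, diagonal_apply]

lemma isEigenvalueTuple_blockDiag {n : ℕ} (hn : 3 ≤ n) {P : Matrix (Fin 3) (Fin 3) ℝ}
    {d : Fin n → ℝ} {μ : Fin n → ℂ}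
    (hP : (P.map Complex.ofReal).charpoly
      = ∏ k : Fin 3, (Polynomial.X - Polynomial.C (μ (Fin.castLE hn k))))
    (hd : ∀ i : Fin n, 3 ≤ (i : ℕ) → μ i = d i) :
    IsEigenvalueTuple (blockDiag P d) μ := by
  obtain ⟨m, rfl⟩ := Nat.exists_eq_add_of_le hn
  rw [IsEigenvalueTuple, blockDiag_eq_submatrix_fromBlocks, ← submatrix_map, fromBlocks_map]
  have h := charpoly_reindex (finSumFinEquiv (m := 3) (n := m))
    (fromBlocks (P.map Complex.ofReal) (Matrix.map 0 Complex.ofReal) (Matrix.map 0 Complex.ofReal)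
      ((diagonal fun j => d (Fin.natAdd 3 j)).map Complex.ofReal))
  rw [reindex_apply] at h
  rw [h, Matrix.map_zero _ Complex.ofReal_zero, charpoly_fromBlocks_zero₁₂, hP,
    diagonal_map Complex.ofReal_zero, charpoly_diagonal, Fin.prod_univ_add]
  congr 1
  refine Finset.prod_congr rfl fun j _ => ?_
  rw [hd _ (by simp)]

/-- The matrix of the multiplication by `(s, w)` on `ℝ × ℂ`, in the coordinates `x₀` and
`z = x₁ - i x₂`. -/
def rotBlock (s : ℝ) (w : ℂ) : Matrix (Fin 3) (Fin 3) ℝ :=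
  !![s, 0, 0; 0, w.re, w.im; 0, -w.im, w.re]

lemma charpoly_rotBlock (s : ℝ) (w : ℂ) :
    ((rotBlock s w).map Complex.ofReal).charpoly = (Polynomial.X - Polynomial.C (s : ℂ)) *
      (Polynomial.X - Polynomial.C w) * (Polynomial.X - Polynomial.C ((starRingEnd ℂ) w)) := by
  have h1 : (Polynomial.C (w.re : ℂ)) * 2 = Polynomial.C w + Polynomial.C ((starRingEnd ℂ) w) := by
    rw [← Polynomial.C_add, Complex.add_conj, Complex.ofReal_mul, Polynomial.C_mul, mul_comm]
    rfl
  have h2 : Polynomial.C (w.re : ℂ) * Polynomial.C (w.re : ℂ)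
      + Polynomial.C (w.im : ℂ) * Polynomial.C (w.im : ℂ)
      = Polynomial.C w * Polynomial.C ((starRingEnd ℂ) w) := by
    rw [← Polynomial.C_mul, ← Polynomial.C_mul, ← Polynomial.C_mul, ← Polynomial.C_add,
      Complex.mul_conj, Complex.normSq_apply]
    push_cast; rfl
  rw [charpoly, det_fin_three]
  simp [rotBlock]
  linear_combination (Polynomial.X - Polynomial.C (s : ℂ)) * (h2 - Polynomial.X * h1)

/-- The block diagonal matrices built on `rotBlock` form a commutative ring, a product of copies of
`ℝ` and of one copy of `ℂ`. -/
def rotBlockHom (m : ℕ) :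
    (ℝ × ℂ) × (Fin m → ℝ) →+* Matrix (Fin (3 + m)) (Fin (3 + m)) ℝ where
  toFun x := (fromBlocks (rotBlock x.1.1 x.1.2) 0 0 (diagonal x.2)).submatrix
    finSumFinEquiv.symm finSumFinEquiv.symm
  map_one' := by
    have : rotBlock 1 1 = 1 := by
      ext i j; fin_cases i <;> fin_cases j <;> simp [rotBlock]
    simp [this, Pi.one_def]
  map_zero' := by
    have : rotBlock 0 0 = 0 := by
      ext i j; fin_cases i <;> fin_cases j <;> simp [rotBlock]
    simp [this, Pi.zero_def]
  map_mul' x y := by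
    have : rotBlock (x.1.1 * y.1.1) (x.1.2 * y.1.2)
        = rotBlock x.1.1 x.1.2 * rotBlock y.1.1 y.1.2 := by
      ext i j
      fin_cases i <;> fin_cases j <;> simp [rotBlock, Matrix.mul_apply, Fin.sum_univ_three] <;> ring
    rw [submatrix_mul_equiv, fromBlocks_multiply]
    simp [this, Pi.mul_def]
  map_add' x y := by
    have : rotBlock (x.1.1 + y.1.1) (x.1.2 + y.1.2)
        = rotBlock x.1.1 x.1.2 + rotBlock y.1.1 y.1.2 := by
      ext i j
      fin_cases i <;> fin_cases j <;> simp [rotBlock]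
      ring
    have h2 : fromBlocks (rotBlock (x + y).1.1 (x + y).1.2) 0 0 (diagonal (x + y).2)
        = fromBlocks (rotBlock x.1.1 x.1.2) 0 0 (diagonal x.2)
          + fromBlocks (rotBlock y.1.1 y.1.2) 0 0 (diagonal y.2) := by
      rw [fromBlocks_add, diagonal_add]
      simp [this, Pi.add_def]
    rw [h2]
    rfl

lemma continuous_rotBlockHom (m : ℕ) : Continuous (rotBlockHom m) := by
  have h : Continuous fun x : (ℝ × ℂ) × (Fin m → ℝ) => rotBlock x.1.1 x.1.2 := by
    refine continuous_matrix fun i j => ?_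
    fin_cases i <;> fin_cases j <;> simp [rotBlock] <;> fun_prop
  exact (Continuous.matrix_fromBlocks h continuous_const continuous_const
    (continuous_snd.matrix_diagonal)).matrix_submatrix _ _

lemma exp_blockDiag_rotBlock {n : ℕ} (hn : 3 ≤ n) (s : ℝ) (w : ℂ) (d : Fin n → ℝ) :
    NormedSpace.exp (blockDiag (rotBlock s w) d)
      = blockDiag (rotBlock (Real.exp s) (Complex.exp w)) fun i => Real.exp (d i) := by
  obtain ⟨m, rfl⟩ := Nat.exists_eq_add_of_le hn
  have key : NormedSpace.exp (rotBlockHom m ((s, w), fun j => d (Fin.natAdd 3 j)))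
      = rotBlockHom m (NormedSpace.exp ((s, w), fun j => d (Fin.natAdd 3 j))) := by
    let : NormedRing (Matrix (Fin (3 + m)) (Fin (3 + m)) ℝ) := Matrix.linftyOpNormedRing
    exact (NormedSpace.map_exp (rotBlockHom m) (continuous_rotBlockHom m) _).symm
  have e : NormedSpace.exp ((s, w), fun j => d (Fin.natAdd 3 j))
      = ((Real.exp s, Complex.exp w), fun j => Real.exp (d (Fin.natAdd 3 j))) := by
    refine Prod.ext (Prod.ext ?_ ?_) ?_
    · rw [Prod.fst_exp, Prod.fst_exp, Real.exp_eq_exp_ℝ]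
    · rw [Prod.fst_exp, Prod.snd_exp, Complex.exp_eq_exp_ℂ]
    · rw [Prod.snd_exp, Pi.exp_def, Real.exp_eq_exp_ℝ]
  rw [e] at key
  rw [blockDiag_eq_submatrix_fromBlocks, blockDiag_eq_submatrix_fromBlocks]
  exact key

lemma blockA_eq : blockA = rotBlock (Real.exp 8) rotEigenvalue := by
  rw [rotEigenvalue_eq, rotBlock, blockA]
  generalize √2 / 2 * Real.exp 1 = s
  simp

lemma blockB_eq : blockB = rotBlock 8 (1 + Real.pi / 4 * Complex.I) := by
  have : (1 + Real.pi / 4 * Complex.I : ℂ) = (1 : ℝ) + (Real.pi / 4 : ℝ) * Complex.I := by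
    push_cast; rfl
  rw [this, rotBlock, blockB]
  simp

lemma conj_one_add_pi_div_four_mul_I :
    (starRingEnd ℂ) (1 + Real.pi / 4 * Complex.I) = 1 - Real.pi / 4 * Complex.I := by
  rw [map_add, map_mul, map_one, map_div₀, Complex.conj_ofReal, Complex.conj_I, map_ofNat]
  ring

variable {n : ℕ}

lemma exp_blockDiag_blockB (hn : 3 ≤ n) {d : Fin n → ℝ} (hd : ∀ i : Fin n, 3 ≤ (i : ℕ) → 1 < d i) :
    NormedSpace.exp (blockDiag blockB fun i => Real.log (d i)) = blockDiag blockA d := by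
  rw [blockB_eq, blockA_eq, exp_blockDiag_rotBlock hn, rotEigenvalue]
  ext i j
  simp only [blockDiag, of_apply]
  split_ifs with h1 h2
  · rfl
  · subst h2
    rw [Real.exp_log (by linarith [hd i (by omega)])]
  · rfl

lemma isEigenvalueTuple_blockDiag_blockA (hn : 3 ≤ n) (d : Fin n → ℝ) :
    IsEigenvalueTuple (blockDiag blockA d) (exampleEigenvalues d) := by
  refine isEigenvalueTuple_blockDiag hn ?_ fun i hi => ?_
  · rw [blockA_eq, charpoly_rotBlock, Fin.prod_univ_three, rotEigenvalue, ← Complex.exp_conj,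
      conj_one_add_pi_div_four_mul_I]
    simp [exampleEigenvalues]
  · rw [exampleEigenvalues, if_neg (by omega), if_neg (by omega), if_neg (by omega)]

lemma norm_exampleEigenvalues_ne_one {d : Fin n → ℝ} (hd : ∀ i : Fin n, 3 ≤ (i : ℕ) → 1 < d i)
    (i : Fin n) : ‖exampleEigenvalues d i‖ ≠ 1 := by
  rw [exampleEigenvalues]
  split_ifs with h0 h1 h2
  · simp [Complex.norm_exp]
  · simp [Complex.norm_exp]
  · simp [Complex.norm_exp]
  · have := hd i (by omega)
    rw [Complex.norm_real, Real.norm_of_nonneg (by linarith)]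
    exact this.ne'

lemma isHyperbolic_blockDiag_blockA (hn : 3 ≤ n) {d : Fin n → ℝ}
    (hd : ∀ i : Fin n, 3 ≤ (i : ℕ) → 1 < d i) : IsHyperbolic (blockDiag blockA d) := by
  intro z hz
  rw [isEigenvalueTuple_blockDiag_blockA hn d, Polynomial.IsRoot, Polynomial.eval_prod,
    Finset.prod_eq_zero_iff] at hz
  obtain ⟨i, -, hi⟩ := hz
  rw [Polynomial.eval_sub, Polynomial.eval_X, Polynomial.eval_C, sub_eq_zero] at hi
  rw [hi]
  exact norm_exampleEigenvalues_ne_one hd i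

/-- With `μ₀ = 8` and `μ₁ = 1 + iπ/4`, the weak resonance is `μ₀ - 8 μ₁ = -2πi`. -/
lemma exists_weaklyResonant_blockDiag_blockB (hn : 3 ≤ n) (d : Fin n → ℝ) :
    ∃ μ : Fin n → ℂ, IsEigenvalueTuple (blockDiag blockB d) μ ∧ WeaklyResonant μ := by
  refine ⟨fun i => if (i : ℕ) = 0 then 8 else if (i : ℕ) = 1 then 1 + Real.pi / 4 * Complex.I
    else if (i : ℕ) = 2 then 1 - Real.pi / 4 * Complex.I else d i,
    isEigenvalueTuple_blockDiag hn ?_ fun i hi => ?_,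
    Pi.single (Fin.castLE hn 1) 8, Fin.castLE hn 0, -1, ?_, by norm_num, ?_⟩
  · rw [blockB_eq, charpoly_rotBlock, Fin.prod_univ_three, conj_one_add_pi_div_four_mul_I]
    simp
  · rw [if_neg (by omega), if_neg (by omega), if_neg (by omega)]
  · simp
  · rw [Finset.sum_eq_single (Fin.castLE hn 1) (fun i _ hi => by simp [hi]) (by simp)]
    simp
    ring

end Matrices

/-! ### The nonlinear term and the local diffeomorphism -/

section Diffeo

variable {n : ℕ} (hn : 3 ≤ n)

lemma resonantTerm_isBigO (a : ℝ) (b : ℂ) :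
    resonantTerm hn a b =O[𝓝 0] fun x => ‖x‖ ^ 2 := by
  have h1 : (fun x : Rn n => planeCoord hn x) =O[𝓝 0] fun x => x := (planeCoord hn).isBigO_id _
  have h2 : resonantTerm hn a b =O[𝓝 0] fun x => ‖planeCoord hn x‖ ^ 8 := by
    refine IsBigO.of_bound (|a| + 2 * ‖b‖) (Eventually.of_forall fun x => ?_)
    rw [resonantTerm_eq, norm_smul, PiLp.norm_single, norm_one, mul_one,
      Real.norm_of_nonneg (by positivity : 0 ≤ ‖planeCoord hn x‖ ^ 8), resonantPoly,
      Complex.normSq_eq_norm_sq, Real.norm_eq_abs]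
    have h3 := Complex.abs_re_le_norm (b * planeCoord hn x ^ 8)
    rw [norm_mul, norm_pow] at h3
    refine (abs_add_le _ _).trans ?_
    rw [abs_mul, abs_mul, abs_two, abs_of_nonneg (by positivity : 0 ≤ (‖planeCoord hn x‖ ^ 2) ^ 4)]
    nlinarith
  have h4 : (fun x : Rn n => ‖x‖ ^ 8) =O[𝓝 0] fun x => ‖x‖ ^ 2 := by
    refine IsBigO.of_bound 1 ?_
    filter_upwards [Metric.ball_mem_nhds (0 : Rn n) one_pos] with x hx
    rw [mem_ball_zero_iff] at hx
    rw [norm_pow, norm_pow, norm_norm, one_mul]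
    exact pow_le_pow_of_le_one (norm_nonneg x) hx.le (by norm_num)
  exact (h2.trans (h1.norm_norm.pow 8)).trans h4

/-- The nonlinear term depends on `z` alone and is directed along the eigenvector `e₀`, on which `z`
vanishes; so `x ↦ A x + f x` has the global inverse `y ↦ A⁻¹ (y - f (A⁻¹ y))`. -/
lemma isLocalDiffeo_perturbed {d : Fin n → ℝ} (hA : IsUnit (blockDiag blockA d)) (a : ℝ) (b : ℂ)
    (r : WithTop ℕ∞) : IsLocalDiffeo r (perturbed (blockDiag blockA d) (resonantTerm hn a b)) := by
  obtain ⟨u, hu⟩ := hA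
  set A := Matrix.toEuclideanCLM (n := Fin n) (𝕜 := ℝ) (blockDiag blockA d) with hAdef
  set B := Matrix.toEuclideanCLM (n := Fin n) (𝕜 := ℝ) (↑u⁻¹ : Matrix (Fin n) (Fin n) ℝ) with hBdef
  have hAB : ∀ x, A (B x) = x := fun x => by
    rw [← mul_apply_eq_comp, hAdef, hBdef, ← map_mul, ← hu, Units.mul_inv, map_one]
    rfl
  have hBA : ∀ x, B (A x) = x := fun x => by
    rw [← mul_apply_eq_comp, hAdef, hBdef, ← map_mul, ← hu, Units.inv_mul, map_one]
    rfl
  set e : Rn n := EuclideanSpace.single (Fin.castLE hn 0) 1 with he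
  have hze : planeCoord hn e = 0 := planeCoord_single_of_ne hn (by simp) (by simp) 1
  have hzB : planeCoord hn (B e) = 0 := by
    have h1 := planeCoord_blockDiag_blockA hn d (B e)
    rw [← hAdef, hAB, hze] at h1
    exact (mul_eq_zero.1 h1.symm).resolve_left (Complex.exp_ne_zero _)
  refine ⟨perturbed_zero hn d a b, ?_⟩
  let Φ : Rn n ≃ₘ^r⟮𝓘(ℝ, Rn n), 𝓘(ℝ, Rn n)⟯ Rn n :=
    { toFun := perturbed (blockDiag blockA d) (resonantTerm hn a b)
      invFun := fun y => B (y - resonantPoly a b (planeCoord hn (B y)) • e)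
      left_inv := fun x => by
        beta_reduce
        rw [perturbed_eq, ← hAdef, ← he, map_sub, map_smul, map_add, map_smul, hBA, map_add,
          map_smul, hzB, smul_zero, add_zero, add_sub_cancel_right]
      right_inv := fun y => by
        beta_reduce
        rw [perturbed_eq, ← hAdef, ← he, hAB, map_sub, map_smul, map_sub, map_smul, hzB, smul_zero,
          sub_zero, sub_add_cancel]
      contMDiff_toFun := (contDiff_perturbed hn d a b).contMDiff
      contMDiff_invFun := (B.contDiff.comp (contDiff_id.sub
        (((contDiff_resonantPoly a b).comp ((planeCoord hn).contDiff.comp B.contDiff)).smul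
          contDiff_const))).contMDiff }
  exact Φ.isLocalDiffeomorph 0

end Diffeo

/-! ### Admissible eigenvalues -/

lemma sum_eq_sum_castLE {n : ℕ} (hn : 3 ≤ n) {M : Type*} [AddCommMonoid M] (g : Fin n → M)
    (h : ∀ i : Fin n, 3 ≤ (i : ℕ) → g i = 0) :
    ∑ i, g i = g (Fin.castLE hn 0) + g (Fin.castLE hn 1) + g (Fin.castLE hn 2) := by
  obtain ⟨m, rfl⟩ := Nat.exists_eq_add_of_le hn
  rw [Fin.sum_univ_add, Finset.sum_eq_zero (s := (Finset.univ : Finset (Fin m)))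
    (fun j _ => h _ (by simp)), add_zero, Fin.sum_univ_three]
  rfl

/-- Choose the logarithms of the moduli of the eigenvalues to be `8, 1, 1` and the powers
`θ ^ (2 (i - 2))` of a transcendental number; a multiplicative relation among the eigenvalues then is
an identity between integer polynomials in `θ`. -/
theorem exists_admissible {n : ℕ} (hn : 3 ≤ n) : ∃ d : Fin n → ℝ, Admissible d := by
  obtain ⟨θ, hθ⟩ : ∃ θ : ℝ, Transcendental ℤ θ := ⟨_, transcendental_liouvilleNumber le_rfl⟩
  have hθ0 : θ ≠ 0 := by
    rintro rfl; exact hθ isAlgebraic_zero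
  -- The exponent `2 (i - 2)` is zero for `i < 3` and makes the power positive.
  set e : Fin n → ℕ := fun i => 2 * ((i : ℕ) - 2) with he
  set c : Fin n → ℕ := fun i => if (i : ℕ) = 0 then 8 else 1 with hc
  set d : Fin n → ℝ := fun i => Real.exp (θ ^ e i) with hd
  refine ⟨d, fun i hi => Real.one_lt_exp_iff.2 ?_, fun k j hk hrel => ?_⟩
  · simp only [he, pow_mul]; positivity
  have hnorm : ∀ i, ‖exampleEigenvalues d i‖ = Real.exp (c i * θ ^ e i) := by
    intro i
    simp only [exampleEigenvalues, hc, he]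
    split_ifs with h0 h1 h2
    · simp [Complex.norm_exp, h0]
    · simp [Complex.norm_exp, h1]
    · simp [Complex.norm_exp, h2]
    · rw [Complex.norm_real, hd, Real.norm_of_nonneg (Real.exp_pos _).le]
      simp [he]
  have hlog : (c j : ℝ) * θ ^ e j = ∑ i, (k i : ℝ) * (c i * θ ^ e i) := by
    have h := congrArg norm hrel
    simp only [norm_prod, norm_pow, hnorm, ← Real.exp_nat_mul, ← Real.exp_sum] at h
    exact Real.exp_injective h
  have hpoly : (Polynomial.C (c j : ℤ) * Polynomial.X ^ e j : Polynomial ℤ)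
      = ∑ i, Polynomial.C ((k i * c i : ℕ) : ℤ) * Polynomial.X ^ e i := by
    refine (transcendental_iff_injective.1 hθ) ?_
    simp only [map_sum, map_mul, map_pow, Polynomial.aeval_X, Polynomial.aeval_C]
    simpa [mul_assoc] using hlog
  have hcoeff : ∀ m, (if m = e j then c j else 0) = ∑ i, if m = e i then k i * c i else 0 := by
    intro m
    have h := congrArg (fun p => Polynomial.coeff p m) hpoly
    simp only [Polynomial.coeff_C_mul_X_pow, Polynomial.finsetSum_coeff] at h
    exact_mod_cast h
  have hhigh : ∀ i : Fin n, 3 ≤ (i : ℕ) → k i = if i = j then 1 else 0 := by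
    intro i hi
    have hinj : ∀ l, e i = e l ↔ i = l := by
      intro l
      simp only [he, Fin.ext_iff]
      omega
    have h := hcoeff (e i)
    simp only [hinj, Finset.sum_ite_eq, Finset.mem_univ, if_true] at h
    have hci : c i = 1 := if_neg (by omega)
    rw [hci, mul_one] at h
    rw [← h]
    split_ifs with h1
    · rw [← h1, hci]
    · rfl
  have hlow : (if (j : ℕ) < 3 then c j else 0) = 8 * k (Fin.castLE hn 0) + k (Fin.castLE hn 1)
      + k (Fin.castLE hn 2) := by
    have h := hcoeff 0
    have h0 : ∀ l : Fin n, 0 = e l ↔ (l : ℕ) < 3 := by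
      intro l; simp only [he]; omega
    simp only [h0] at h
    rw [sum_eq_sum_castLE hn _ fun i hi => if_neg (by omega)] at h
    rw [h]
    simp [hc, mul_comm]
  rcases lt_or_ge (j : ℕ) 3 with hj | hj
  · have hz : ∀ i : Fin n, 3 ≤ (i : ℕ) → k i = 0 := fun i hi => by
      rw [hhigh i hi, if_neg]; rintro rfl; omega
    rw [sum_eq_sum_castLE hn _ hz] at hk
    rw [if_pos hj] at hlow
    have hj0 : (j : ℕ) = 0 := by
      by_contra h0
      have : c j = 1 := if_neg h0
      omega
    have hcj : c j = 8 := if_pos hj0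
    rw [hcj] at hlow
    have hk0 : k (Fin.castLE hn 0) = 0 := by omega
    refine ⟨hj0, k (Fin.castLE hn 1), k (Fin.castLE hn 2), ?_, fun i => ?_⟩
    · -- The moduli agree; comparing arguments shows that `8` divides `k₁ - k₂`.
      have hprod : ∏ i, exampleEigenvalues d i ^ k i
          = Complex.exp ((k (Fin.castLE hn 1) : ℂ) * (1 + Real.pi / 4 * Complex.I))
            * Complex.exp ((k (Fin.castLE hn 2) : ℂ) * (1 - Real.pi / 4 * Complex.I)) := by
        have := sum_eq_sum_castLE hn (M := Additive ℂ)
          (fun i => Additive.ofMul (exampleEigenvalues d i ^ k i))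
          (fun i hi => by rw [hz i hi, pow_zero]; rfl)
        have h2 : ∏ i, exampleEigenvalues d i ^ k i
            = exampleEigenvalues d (Fin.castLE hn 0) ^ k (Fin.castLE hn 0)
              * exampleEigenvalues d (Fin.castLE hn 1) ^ k (Fin.castLE hn 1)
              * exampleEigenvalues d (Fin.castLE hn 2) ^ k (Fin.castLE hn 2) := this
        rw [h2, hk0, Complex.exp_nat_mul, Complex.exp_nat_mul]
        simp [exampleEigenvalues]
      rw [hprod, ← Complex.exp_add, exampleEigenvalues, if_pos hj0, Complex.exp_eq_exp_iff_exists_int]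
        at hrel
      obtain ⟨N, hN⟩ := hrel
      have him := congrArg Complex.im hN
      simp at him
      have h3 : (k (Fin.castLE hn 1) : ℝ) - k (Fin.castLE hn 2) + 8 * N = 0 := by
        have hpi := Real.pi_ne_zero
        have : Real.pi * ((k (Fin.castLE hn 1) : ℝ) - k (Fin.castLE hn 2) + 8 * N) = 0 := by
          linarith
        exact (mul_eq_zero.1 this).resolve_left hpi
      have h4 : (k (Fin.castLE hn 1) : ℤ) - k (Fin.castLE hn 2) + 8 * N = 0 := by exact_mod_cast h3
      omega
    · split_ifs with h1 h2
      · exact congrArg k (Fin.ext h1)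
      · exact congrArg k (Fin.ext h2)
      · rcases lt_or_ge (i : ℕ) 3 with hi | hi
        · rw [← hk0]
          exact congrArg k (Fin.ext (by simp; omega))
        · exact hz i hi
  · exfalso
    rw [if_neg (by omega)] at hlow
    have hall : ∀ i, k i = if i = j then 1 else 0 := by
      intro i
      rcases lt_or_ge (i : ℕ) 3 with hi | hi
      · obtain ⟨l, rfl⟩ : ∃ l : Fin 3, i = Fin.castLE hn l := ⟨⟨i, hi⟩, rfl⟩
        rw [if_neg (by rintro rfl; omega)]
        fin_cases l <;> simp <;> omega
      · exact hhigh i hi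
    simp only [hall, Finset.sum_ite_eq', Finset.mem_univ, if_true] at hk
    omega

end EmbeddingFlow

open EmbeddingFlow in
theorem theorem1p2 (n : ℕ) (hn : 3 ≤ n) :
    (∀ r : WithTop ℕ∞, (r = ∞ ∨ r = ω) →
      ∃ (A : Matrix (Fin n) (Fin n) ℝ) (f : Rn n → Rn n),
        f =O[𝓝 0] (fun x => ‖x‖ ^ 2) ∧
        IsLocalDiffeo r (perturbed A f) ∧
        IsHyperbolic A ∧
        (∃ B : Matrix (Fin n) (Fin n) ℝ, NormedSpace.exp B = A ∧
          ∃ μ : Fin n → ℂ, IsEigenvalueTuple B μ ∧ WeaklyResonant μ) ∧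
        ¬ ∃ X : Rn n → Rn n, IsEmbeddingVectorField r X (perturbed A f)) ∧
    (∃ d : Fin n → ℝ, Admissible d) ∧
    (∀ (d : Fin n → ℝ) (a : ℝ) (b : ℂ), Admissible d → b ≠ 0 →
      resonantTerm hn a b =O[𝓝 0] (fun x => ‖x‖ ^ 2) ∧
      IsLocalDiffeo ω (perturbed (blockDiag blockA d) (resonantTerm hn a b)) ∧
      IsHyperbolic (blockDiag blockA d) ∧
      IsEigenvalueTuple (blockDiag blockA d) (exampleEigenvalues d) ∧
      NormedSpace.exp (blockDiag blockB fun i => Real.log (d i)) = blockDiag blockA d ∧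
      (∃ μ : Fin n → ℂ, IsEigenvalueTuple (blockDiag blockB fun i => Real.log (d i)) μ ∧
        WeaklyResonant μ) ∧
      (¬ ∃ X : Rn n → Rn n, IsEmbeddingVectorField ∞ X
        (perturbed (blockDiag blockA d) (resonantTerm hn a b))) ∧
      (¬ ∃ X : Rn n → Rn n, IsEmbeddingVectorField ω X
        (perturbed (blockDiag blockA d) (resonantTerm hn a b)))) := by
  have hexp : ∀ d : Fin n → ℝ, Admissible d →
      NormedSpace.exp (blockDiag blockB fun i => Real.log (d i)) = blockDiag blockA d :=
    fun d hd => exp_blockDiag_blockB hn hd.1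
  have hunit : ∀ d : Fin n → ℝ, Admissible d → IsUnit (blockDiag blockA d) := fun d hd =>
    hexp d hd ▸ Matrix.isUnit_exp _
  have hnot : ∀ r : WithTop ℕ∞, (r = ∞ ∨ r = ω) → ∀ (d : Fin n → ℝ) (a : ℝ) (b : ℂ),
      Admissible d → b ≠ 0 → ¬ ∃ X : Rn n → Rn n, IsEmbeddingVectorField r X
        (perturbed (blockDiag blockA d) (resonantTerm hn a b)) := by
    rintro r hr d a b hd hb ⟨X, U, hU, h0, hX, h⟩
    have hr' : (∞ : WithTop ℕ∞) ≤ r := by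
      rcases hr with rfl | rfl
      exacts [le_rfl, le_top]
    exact not_exists_isEmbeddingVectorField hn d hd.1 a hb ⟨X, U, hU, h0, hX.of_le hr', h⟩
  refine ⟨fun r hr => ?_, exists_admissible hn, fun d a b hd hb =>
    ⟨resonantTerm_isBigO hn a b, isLocalDiffeo_perturbed hn (hunit d hd) a b ω,
      isHyperbolic_blockDiag_blockA hn hd.1, isEigenvalueTuple_blockDiag_blockA hn d, hexp d hd,
      exists_weaklyResonant_blockDiag_blockB hn _, hnot ∞ (Or.inl rfl) d a b hd hb,
      hnot ω (Or.inr rfl) d a b hd hb⟩⟩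
  obtain ⟨d, hd⟩ := exists_admissible hn
  exact ⟨blockDiag blockA d, resonantTerm hn 0 1, resonantTerm_isBigO hn 0 1,
    isLocalDiffeo_perturbed hn (hunit d hd) 0 1 r, isHyperbolic_blockDiag_blockA hn hd.1,
    ⟨_, hexp d hd, exists_weaklyResonant_blockDiag_blockB hn _⟩, hnot r hr d 0 1 hd one_ne_zero⟩
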